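/- Identify subsets of $\mathbb N$ with points of Cantor space $2^{\mathbb N}$, and let $(W_e)_{e\in\mathbb N}$ be the standard listing of the c.e. sets of natural numbers. A $\Pi^0_1$ class is a class $P\subseteq 2^{\mathbb N}$ of the form $P=\{Z : \forall n\; Z\restriction n\notin S\}$ for a c.e. set $S$ of binary strings; it is called special if it is nonempty and has no computable member. A function $f:\mathbb N\to\mathbb N$ is $\omega$-c.e. by a set $A$ if $f(x)=\lim_t g(x,t)$ for some $A$-computable function $g$ such that for some computable (not merely $A$-computable) function $b$, $|\{t : g(x,t+1)\neq g(x,t)\}|\le b(x)$ for every $x$; it is $\omega$-c.e. if this holds with $g$ computable. An order function is a computable, nondecreasing, unbounded function $h:\mathbb N\to\mathbb N$. A BLR trace with bound $h$ is a sequence $(T_n)_{n\in\mathbb N}$ with $T_n=W_{r(n)}$ for some $\omega$-c.e. function $r$, and with $|T_n|\le h(n)$ for each $n$; it is a trace for $f$ if $f(n)\in T_n$ for every $n$. A set $A$ is BLR traceable if there is an order function $h$ such that every function that is $\omega$-c.e. by $A$ has a BLR trace with bound $h$. **Theorem.** There is a special $\Pi^0_1$ class $P$ all of whose members are BLR traceable.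 Moreover, the bound can be taken to be $2^n$: for every $A\in P$, every function that is $\omega$-c.e. by $A$ has a BLR trace with bound $h(n)=2^n$. -/

import Mathlib

/-!
Sets of natural numbers are identified with points of Cantor space `ℕ → Bool`
(via characteristic functions).
-/

namespace BLR

/-- The string consisting of the first `n` bits of `Z`. -/
def initialSegment (Z : ℕ → Bool) (n : ℕ) : List Bool :=
  (List.range n).map Z

/-- The open class in Cantor space generated by a set `W` of binary strings. -/
def openClass (W : Set (List Bool)) : Set (ℕ → Bool) :=
  {Z | ∃ n, initialSegment Z n ∈ W}

/-- A `Π⁰₁` class: the complement of an open class generated by a c.e. set of strings. -/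
def IsPi01Class (P : Set (ℕ → Bool)) : Prop :=
  ∃ W : Set (List Bool), REPred (fun σ => σ ∈ W) ∧ P = (openClass W)ᶜ

/-- A special `Π⁰₁` class: nonempty and without computable members. -/
structure IsSpecialPi01Class (P : Set (ℕ → Bool)) : Prop where
  isPi01Class : IsPi01Class P
  nonempty : P.Nonempty
  not_computable : ∀ A ∈ P, ¬ Computable A

/-- The characteristic function of `A`, as an oracle. -/
def oracle (A : ℕ → Bool) : ℕ →. ℕ :=
  fun n => Part.some (A n).toNat

/-- `g` is an approximation of `f` with limits taken in the second variable, such that the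
number of changes of `g x` is bounded by `b x`. -/
def Approximates (g : ℕ → ℕ → ℕ) (b f : ℕ → ℕ) : Prop :=
  ∀ x, (∀ᶠ t in Filter.atTop, g x t = f x) ∧ {t | g x (t + 1) ≠ g x t}.encard ≤ b x

/-- `f` is `ω`-c.e.: it has a computable approximation with a computable bound on the number of
changes. -/
def OmegaCE (f : ℕ → ℕ) : Prop :=
  ∃ (g : ℕ → ℕ → ℕ) (b : ℕ → ℕ), Computable₂ g ∧ Computable b ∧ Approximates g b f

/-- `f` is `ω`-c.e. by `A`: it has an `A`-computable approximation, and the bound on the number of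
changes is computable (without the help of the oracle). -/
def OmegaCEBy (A : ℕ → Bool) (f : ℕ → ℕ) : Prop :=
  ∃ (g : ℕ → ℕ → ℕ) (b : ℕ → ℕ),
    ComputableIn₂ {oracle A} g ∧ Computable b ∧ Approximates g b f

/-- `W e` is the `e`-th c.e. set, the domain of the `e`-th partial computable function. -/
def W (e : ℕ) : Set ℕ :=
  {x | ((Denumerable.ofNat Nat.Partrec.Code e).eval x).Dom}

/-- A BLR trace: a sequence of c.e. sets with an `ω`-c.e. sequence of indices. -/
def IsBLRTrace (T : ℕ → Set ℕ) : Prop :=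
  ∃ r : ℕ → ℕ, OmegaCE r ∧ ∀ n, T n = W (r n)

/-- An order function: computable, nondecreasing and unbounded. -/
structure IsOrderFunction (h : ℕ → ℕ) : Prop where
  computable : Computable h
  monotone : Monotone h
  unbounded : ∀ k, ∃ n, k ≤ h n

/-- `f` has a BLR trace with bound `h`. -/
def HasBLRTraceWithBound (f h : ℕ → ℕ) : Prop :=
  ∃ T : ℕ → Set ℕ, IsBLRTrace T ∧ (∀ n, (T n).encard ≤ h n) ∧ ∀ n, f n ∈ T n

/-- Every function that is `ω`-c.e. by `A` has a BLR trace with bound `h`. -/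
def IsBLRTraceableWithBound (A : ℕ → Bool) (h : ℕ → ℕ) : Prop :=
  ∀ f : ℕ → ℕ, OmegaCEBy A f → HasBLRTraceWithBound f h

/-- `A` is BLR traceable: a single order function serves as a bound for traces of all functions
that are `ω`-c.e. by `A`. -/
def IsBLRTraceable (A : ℕ → Bool) : Prop :=
  ∃ h : ℕ → ℕ, IsOrderFunction h ∧ IsBLRTraceableWithBound A h

end BLR

open Encodable
open Nat.Partrec (Code)

namespace BLR

/-! The class consists of the paths common to a decreasing sequence of perfect trees `Tasks.tree s`,
built by maximizing counters. Each task owns a level and a bounded counter on strings that grows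
under extension. When an extension of a node at its level is requested and raises the counter, the
node is moved there by precomposing the tree with a substitution. A move increases the weight of the
level it acts on and leaves shallower levels alone. A lexicographic potential therefore shows that
every level settles (`Tasks.exists_tree_stable`), and settled nodes have maximal counters
(`Tasks.exists_count_maximal`). Settling yields a path; a primitive recursive construction yields a
`Π⁰₁` class.

If `f` is `ω`-c.e. by `A`, let a string count the successive values of the approximation to `f x`
that it computes as an oracle, capped by a computable bound (`exists_isCounter`). The current value
can change only when the count grows, so a node on `A` with maximal count already shows `f x`. The
nodes at a level at most `x` thus provide at most `2 ^ x` candidates.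

The list of candidates must change only computably often, although it is not computable how many
tasks ever work at small levels. The remedy is to let a task work at the minimum of its own level
and those of the later tasks seen so far. Later tasks then never act at shallower levels
(`Tasks.level_mono_left`), and the changes are charged to at most `x` drops of the level, to the
task's own counter and to the computable total bound of the earlier tasks
(`Tasks.encard_nodeValues_changes_le`).

One primitive recursive list of tasks simulates every computable counter with a computable bound, at
all but finitely many arguments (`exists_task_index`). The same list excludes computable members:
for computable `A`, count 1 off `A` and 0 on it. One of the two successors of any node on `A` leaves
`A`, so a maximal node cannot lie on `A` (`Tasks.not_mem_paths`). -/

/-! ### Strings -/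

/-- The list of all binary strings of length `n`. -/
def strings : ℕ → List (List Bool)
  | 0 => [[]]
  | n + 1 => (strings n).map (List.cons false) ++ (strings n).map (List.cons true)

theorem mem_strings {n : ℕ} {σ : List Bool} : σ ∈ strings n ↔ σ.length = n := by
  induction n generalizing σ with
  | zero => simp [strings]
  | succ n ih =>
    cases σ with
    | nil => simp [strings]
    | cons b σ => cases b <;> simp [strings, ih]

theorem length_strings (n : ℕ) : (strings n).length = 2 ^ n := by
  induction n with
  | zero => rfl
  | succ n ih => simp [strings, ih]; ring

theorem length_initialSegment (Z : ℕ → Bool) (n : ℕ) : (initialSegment Z n).length = n := by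
  simp [initialSegment]

theorem initialSegment_prefix (Z : ℕ → Bool) {m n : ℕ} (h : m ≤ n) :
    initialSegment Z m <+: initialSegment Z n := by
  obtain ⟨k, rfl⟩ := Nat.exists_eq_add_of_le h
  simp [initialSegment, List.range_add]

theorem eq_initialSegment_of_prefix {Z : ℕ → Bool} {n : ℕ} {τ : List Bool}
    (h : τ <+: initialSegment Z n) : τ = initialSegment Z τ.length := by
  have hl : τ.length ≤ n := by simpa [length_initialSegment] using h.length_le
  exact (List.prefix_of_prefix_length_le h (initialSegment_prefix Z hl)
    (by simp [length_initialSegment])).eq_of_length (by simp [length_initialSegment])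

/-! ### Substitutions -/

/-- The map on strings that replaces the initial part `m.1` by `m.1 ++ m.2`. -/
def substitute (m : List Bool × List Bool) (ρ : List Bool) : List Bool :=
  if ρ.take m.1.length = m.1 then m.1 ++ m.2 ++ ρ.drop m.1.length else ρ

theorem substitute_append (m : List Bool × List Bool) (v : List Bool) :
    substitute m (m.1 ++ v) = m.1 ++ m.2 ++ v := by
  simp [substitute]

theorem substitute_of_not_prefix {m : List Bool × List Bool} {ρ : List Bool} (h : ¬ m.1 <+: ρ) :
    substitute m ρ = ρ := by
  rw [substitute, if_neg]
  intro h'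
  exact h (h' ▸ List.take_prefix _ _)

theorem prefix_substitute_of_prefix {m : List Bool × List Bool} {ρ : List Bool} (h : m.1 <+: ρ) :
    m.1 <+: substitute m ρ := by
  obtain ⟨v, rfl⟩ := h
  simp [substitute_append]

theorem length_le_length_substitute (m : List Bool × List Bool) (ρ : List Bool) :
    ρ.length ≤ (substitute m ρ).length := by
  by_cases h : m.1 <+: ρ
  · obtain ⟨v, rfl⟩ := h
    simp [substitute_append]
  · rw [substitute_of_not_prefix h]

theorem substitute_prefix (m : List Bool × List Bool) {ρ ρ' : List Bool} (h : ρ <+: ρ') :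
    substitute m ρ <+: substitute m ρ' := by
  by_cases h₁ : m.1 <+: ρ
  · obtain ⟨v, rfl⟩ := h₁
    obtain ⟨u, rfl⟩ := h
    simp [List.append_assoc, substitute_append m]
  · rw [substitute_of_not_prefix h₁]
    by_cases h₂ : m.1 <+: ρ'
    · exact ((List.prefix_or_prefix_of_prefix h₂ h).resolve_left h₁).trans
        (prefix_substitute_of_prefix h₂)
    · rwa [substitute_of_not_prefix h₂]

/-- This keeps the trees branching. If only one of the strings extends `m.1`, the other already
disagrees with it inside `m.1`, before the inserted block. -/
theorem substitute_not_prefix (m : List Bool × List Bool) {ρ ρ' : List Bool} (h : ¬ ρ <+: ρ')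
    (h' : ¬ ρ' <+: ρ) : ¬ substitute m ρ <+: substitute m ρ' := by
  intro hs
  by_cases h₁ : m.1 <+: ρ <;> by_cases h₂ : m.1 <+: ρ'
  · obtain ⟨v, rfl⟩ := h₁
    obtain ⟨u, rfl⟩ := h₂
    simp only [substitute_append, List.append_assoc, List.prefix_append_right_inj] at hs h
    exact h hs
  · rw [substitute_of_not_prefix h₂] at hs
    exact h₂ ((prefix_substitute_of_prefix h₁).trans hs)
  · rw [substitute_of_not_prefix h₁] at hs
    rcases List.prefix_or_prefix_of_prefix hs (prefix_substitute_of_prefix h₂) with h₃ | h₃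
    · exact h (h₃.trans h₂)
    · exact h₁ h₃
  · rw [substitute_of_not_prefix h₁, substitute_of_not_prefix h₂] at hs
    exact h hs

/-- Apply a list of substitutions, beginning with the head of the list. -/
def applyMoves (l : List (List Bool × List Bool)) (ρ : List Bool) : List Bool :=
  l.foldl (fun ρ m => substitute m ρ) ρ

theorem applyMoves_cons (m : List Bool × List Bool) (l : List (List Bool × List Bool))
    (ρ : List Bool) : applyMoves (m :: l) ρ = applyMoves l (substitute m ρ) := rfl

theorem length_le_length_applyMoves (l : List (List Bool × List Bool)) (ρ : List Bool) :
    ρ.length ≤ (applyMoves l ρ).length := by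
  induction l generalizing ρ with
  | nil => exact le_rfl
  | cons m l ih => exact (length_le_length_substitute m ρ).trans (ih _)

theorem applyMoves_prefix (l : List (List Bool × List Bool)) {ρ ρ' : List Bool} (h : ρ <+: ρ') :
    applyMoves l ρ <+: applyMoves l ρ' := by
  induction l generalizing ρ ρ' with
  | nil => exact h
  | cons m l ih => exact ih (substitute_prefix m h)

theorem applyMoves_not_prefix (l : List (List Bool × List Bool)) {ρ ρ' : List Bool}
    (h : ¬ ρ <+: ρ') (h' : ¬ ρ' <+: ρ) : ¬ applyMoves l ρ <+: applyMoves l ρ' := by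
  induction l generalizing ρ ρ' with
  | nil => exact h
  | cons m l ih => exact ih (substitute_not_prefix m h h') (substitute_not_prefix m h' h)

/-! ### Lexicographic potentials -/

/-- The number with digits `d 0, …, d n` in base `E`, where `d 0` is the leading digit. -/
def horner (E : ℕ) (d : ℕ → ℕ) : ℕ → ℕ
  | 0 => d 0
  | n + 1 => horner E d n * E + d (n + 1)

theorem horner_congr {E : ℕ} {d d' : ℕ → ℕ} {n : ℕ} (h : ∀ m ≤ n, d m = d' m) :
    horner E d n = horner E d' n := by
  induction n with
  | zero => exact h 0 le_rfl
  | succ n ih => rw [horner, horner, ih fun m hm => h m (by omega), h (n + 1) le_rfl]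

theorem horner_lt_pow {E : ℕ} {d : ℕ → ℕ} {n : ℕ} (h : ∀ m ≤ n, d m < E) :
    horner E d n < E ^ (n + 1) := by
  induction n with
  | zero => simpa [horner] using h 0 le_rfl
  | succ n ih =>
    have h₁ := ih fun m hm => h m (by omega)
    have h₂ := h (n + 1) le_rfl
    rw [horner, pow_succ]
    nlinarith

theorem horner_le_of_last {E : ℕ} {d d' : ℕ → ℕ} {n : ℕ} (h : ∀ m < n, d m = d' m)
    (hn : d n ≤ d' n) : horner E d n ≤ horner E d' n := by
  cases n with
  | zero => exact hn
  | succ n =>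
    rw [horner, horner, horner_congr fun m hm => h m (by omega)]
    omega

/-- A gain of one in digit `k` outweighs the loss of all later digits of `d`, since these are below
`E`; the digits of `d'` need no bound. -/
theorem horner_lt {E : ℕ} {d d' : ℕ → ℕ} {n k : ℕ} (hE : ∀ m ≤ n, d m < E) (hk : k ≤ n)
    (h : ∀ m < k, d m = d' m) (hd : d k < d' k) : horner E d n < horner E d' n := by
  induction n with
  | zero =>
    obtain rfl : k = 0 := by omega
    exact hd
  | succ n ih =>
    rw [horner, horner]
    rcases Nat.lt_or_ge n k with hnk | hnk
    · obtain rfl : k = n + 1 := by omega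
      rw [horner_congr fun m hm => h m (by omega)]
      omega
    · have h₁ := ih (fun m hm => hE m (by omega)) hnk
      have h₂ := hE (n + 1) le_rfl
      nlinarith

/-- A monotone sequence of natural numbers below `M` increases at most `M` times. -/
theorem encard_setOf_lt_succ_le {φ : ℕ → ℕ} {M : ℕ} (hφ : Monotone φ) (hM : ∀ s, φ s < M) :
    {s | φ s < φ (s + 1)}.encard ≤ M := by
  have hinj : Set.InjOn φ {s | φ s < φ (s + 1)} := by
    intro s hs t ht hst
    simp only [Set.mem_ofPred_eq] at hs ht
    rcases lt_trichotomy s t with h | h | h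
    · have := hφ (show s + 1 ≤ t from h)
      omega
    · exact h
    · have := hφ (show t + 1 ≤ s from h)
      omega
  rw [← hinj.encard_image]
  calc (φ '' {s | φ s < φ (s + 1)}).encard ≤ ((Finset.range M : Finset ℕ) : Set ℕ).encard :=
        Set.encard_le_encard (by rintro _ ⟨s, _, rfl⟩; simpa using hM s)
    _ = M := by rw [Set.encard_coe_eq_coe_finsetCard, Finset.card_range]

/-- A sequence that changes only finitely often is eventually constant. -/
theorem exists_forall_ge_eq_of_finite {α : Type*} {f : ℕ → α}
    (h : {s | f (s + 1) ≠ f s}.Finite) : ∃ s₀, ∀ s ≥ s₀, f s = f s₀ := by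
  obtain ⟨b, hb⟩ := h.bddAbove
  refine ⟨b + 1, fun s hs => ?_⟩
  induction s, hs using Nat.le_induction with
  | base => rfl
  | succ s hs ih =>
    rw [← ih]
    by_contra hne
    have : s ≤ b := hb hne
    omega

/-! ### Weights of levels -/

/-- The total weight of the images under `T` of the strings of length `m`. -/
def levelWeight (w : List Bool → ℕ) (T : List Bool → List Bool) (m : ℕ) : ℕ :=
  ((strings m).map fun σ => w (T σ)).sum

theorem levelWeight_le {w : List Bool → ℕ} {b : ℕ} (hw : ∀ τ, w τ ≤ b)
    (T : List Bool → List Bool) (m : ℕ) : levelWeight w T m ≤ 2 ^ m * b := by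
  have := List.sum_le_card_nsmul ((strings m).map fun σ => w (T σ)) b
    (by simp only [List.mem_map]; rintro _ ⟨σ, _, rfl⟩; exact hw _)
  simpa [levelWeight, length_strings] using this

theorem not_prefix_of_length_lt {σ ρ : List Bool} (h : ρ.length < σ.length) : ¬ σ <+: ρ :=
  fun h' => by have := h'.length_le; omega

section Step

variable {w : List Bool → ℕ} {T T' : List Bool → List Bool} {σ u : List Bool}

theorem levelWeight_eq_of_lt (hT : ∀ ρ, T' ρ = T (substitute (σ, u) ρ)) {m : ℕ}
    (h : m < σ.length) : levelWeight w T m = levelWeight w T' m := by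
  rw [levelWeight, levelWeight]
  congr 1
  refine List.map_congr_left fun ρ hρ => ?_
  rw [mem_strings] at hρ
  rw [hT, substitute_of_not_prefix (not_prefix_of_length_lt (hρ ▸ h))]

/-- Among the strings of length `σ.length` only `σ` itself extends `σ`, so a move at `σ` changes a
single summand of that level. -/
theorem weight_le_of_step (hT : ∀ ρ, T' ρ = T (substitute (σ, u) ρ))
    (hw : w (T σ) ≤ w (T (σ ++ u))) {ρ : List Bool} (hρ : ρ.length = σ.length) :
    w (T ρ) ≤ w (T' ρ) := by
  rw [hT]
  by_cases h : σ <+: ρ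
  · obtain rfl := h.eq_of_length hρ.symm
    have := substitute_append (σ, u) []
    simp only [List.append_nil] at this
    rwa [this]
  · rw [substitute_of_not_prefix h]

theorem levelWeight_le_of_step (hT : ∀ ρ, T' ρ = T (substitute (σ, u) ρ))
    (hw : w (T σ) ≤ w (T (σ ++ u))) : levelWeight w T σ.length ≤ levelWeight w T' σ.length :=
  List.sum_le_sum fun _ hρ => weight_le_of_step hT hw (mem_strings.1 hρ)

theorem levelWeight_lt_of_step (hT : ∀ ρ, T' ρ = T (substitute (σ, u) ρ))
    (hw : w (T σ) < w (T (σ ++ u))) : levelWeight w T σ.length < levelWeight w T' σ.length := by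
  refine List.sum_lt_sum _ _ (fun _ hρ => weight_le_of_step hT hw.le (mem_strings.1 hρ))
    ⟨σ, mem_strings.2 rfl, ?_⟩
  have := substitute_append (σ, u) []
  simp only [List.append_nil] at this
  rwa [hT, this]

end Step

/-! ### The construction -/

/-- A sequence of tasks. The task `p` belongs to the level `lvl p`, and it attempts to make the
counter `count p` as large as possible. -/
structure Tasks where
  /-- the level to which a task belongs -/
  lvl : ℕ → ℕ
  /-- the counter of a task, a function of strings -/
  count : ℕ → List Bool → ℕ
  /-- a bound for the counter of a task -/
  bound : ℕ → ℕ
  count_mono : ∀ p {τ τ' : List Bool}, τ <+: τ' → count p τ ≤ count p τ'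
  count_le_bound : ∀ p τ, count p τ ≤ bound p
  exists_forall_lt_lvl : ∀ n, ∃ I, ∀ j ≥ I, n < lvl j

namespace Tasks

variable (D : Tasks)

/-- The level at which the task `p` is active at stage `s`: the least `D.lvl j` for `p ≤ j ≤ s`. -/
def level (p s : ℕ) : ℕ :=
  Nat.rec (D.lvl p) (fun k l => min l (D.lvl (p + k + 1))) (s - p)

theorem level_of_le {p s : ℕ} (h : s ≤ p) : D.level p s = D.lvl p := by
  rw [level, Nat.sub_eq_zero_of_le h]
  rfl

theorem level_succ {p s : ℕ} (h : p ≤ s) :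
    D.level p (s + 1) = min (D.level p s) (D.lvl (s + 1)) := by
  obtain ⟨k, rfl⟩ := Nat.exists_eq_add_of_le h
  simp only [level, show p + k + 1 - p = k + 1 by omega, show p + k - p = k by omega]

theorem level_antitone (p : ℕ) : Antitone (D.level p) := by
  refine antitone_nat_of_succ_le fun s => ?_
  rcases Nat.lt_or_ge s p with h | h
  · rw [D.level_of_le h.le, D.level_of_le h]
  · rw [D.level_succ h]
    exact min_le_left _ _

theorem level_le_lvl (p s : ℕ) : D.level p s ≤ D.lvl p := by
  rw [← D.level_of_le (Nat.zero_le p)]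
  exact D.level_antitone p (Nat.zero_le s)

theorem exists_level_eq (p s : ℕ) : ∃ j ≥ p, D.level p s = D.lvl j := by
  induction s with
  | zero => exact ⟨p, le_rfl, D.level_of_le (Nat.zero_le p)⟩
  | succ s ih =>
    rcases Nat.lt_or_ge s p with h | h
    · exact ⟨p, le_rfl, D.level_of_le h⟩
    · rw [D.level_succ h]
      rcases min_choice (D.level p s) (D.lvl (s + 1)) with h' | h' <;> rw [h']
      · exact ih
      · exact ⟨s + 1, by omega, rfl⟩

/-- The purpose of the minimum in `level`: a task after `p` that is allowed to act never acts at a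
level shallower than that of `p`. -/
theorem level_mono_left {p q s : ℕ} (hpq : p ≤ q) (hqs : q ≤ s) : D.level p s ≤ D.level q s := by
  induction s, hqs using Nat.le_induction with
  | base =>
    rw [D.level_of_le (le_refl q)]
    cases q with
    | zero => rw [Nat.le_zero.1 hpq]; exact D.level_le_lvl 0 0
    | succ q =>
      rcases hpq.eq_or_lt with rfl | h
      · exact D.level_le_lvl _ _
      · rw [D.level_succ (by omega)]
        exact min_le_right _ _
  | succ s hqs ih =>
    rw [D.level_succ (hpq.trans hqs), D.level_succ hqs]
    exact min_le_min_right _ ih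

theorem exists_level_stable (p : ℕ) : ∃ s₀, ∀ s ≥ s₀, D.level p s = D.level p s₀ := by
  exact ⟨Function.argmin (D.level p), fun s hs =>
    le_antisymm (D.level_antitone p hs) (Function.argmin_le _ _)⟩

/-! ### Requests, moves and trees -/

/-- The string, the extension and the task that are considered at stage `s`. -/
def request (s : ℕ) : (List Bool × List Bool) × ℕ :=
  (decode s.unpair.1).getD (([], []), 0)

/-- The second component of `s.unpair` is mere padding, so each request recurs at arbitrarily late
stages. -/
theorem exists_request_eq (q : (List Bool × List Bool) × ℕ) (s₀ : ℕ) :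
    ∃ s ≥ s₀, request s = q :=
  ⟨Nat.pair (encode q) s₀, Nat.right_le_pair _ _, by simp [request]⟩

/-- The condition for the request of stage `s` to be granted, where `l` lists the earlier moves. -/
def Acts (s : ℕ) (l : List (List Bool × List Bool)) : Prop :=
  (request s).2 ≤ s ∧ (request s).1.1.length = D.level (request s).2 s ∧
    D.count (request s).2 (applyMoves l (request s).1.1) <
      D.count (request s).2 (applyMoves l ((request s).1.1 ++ (request s).1.2))

instance (s : ℕ) (l : List (List Bool × List Bool)) : Decidable (D.Acts s l) :=
  inferInstanceAs (Decidable (_ ∧ _ ∧ _))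

/-- The moves made before stage `s`, the latest one first. -/
def moves : ℕ → List (List Bool × List Bool)
  | 0 => []
  | s + 1 => if D.Acts s (moves s) then (request s).1 :: moves s else moves s

/-- The tree at stage `s`, as a map from strings to strings. -/
def tree (s : ℕ) (ρ : List Bool) : List Bool :=
  applyMoves (D.moves s) ρ

theorem length_le_length_tree (s : ℕ) (ρ : List Bool) : ρ.length ≤ (D.tree s ρ).length :=
  length_le_length_applyMoves _ _

theorem tree_prefix (s : ℕ) {ρ ρ' : List Bool} (h : ρ <+: ρ') : D.tree s ρ <+: D.tree s ρ' :=
  applyMoves_prefix _ h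

theorem tree_not_prefix (s : ℕ) {ρ ρ' : List Bool} (h : ¬ ρ <+: ρ') (h' : ¬ ρ' <+: ρ) :
    ¬ D.tree s ρ <+: D.tree s ρ' :=
  applyMoves_not_prefix _ h h'

theorem tree_succ_of_not_acts {s : ℕ} (h : ¬ D.Acts s (D.moves s)) (ρ : List Bool) :
    D.tree (s + 1) ρ = D.tree s ρ := by
  rw [tree, moves, if_neg h, tree]

theorem tree_succ_of_acts {s : ℕ} (h : D.Acts s (D.moves s)) (ρ : List Bool) :
    D.tree (s + 1) ρ = D.tree s (substitute (request s).1 ρ) := by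
  rw [tree, moves, if_pos h, applyMoves_cons, tree]

theorem acts_iff {s : ℕ} {σ u : List Bool} {p : ℕ} (h : request s = ((σ, u), p)) :
    D.Acts s (D.moves s) ↔ p ≤ s ∧ σ.length = D.level p s ∧
      D.count p (D.tree s σ) < D.count p (D.tree s (σ ++ u)) := by
  rw [Acts, h]
  rfl

theorem tree_succ_cases (s : ℕ) :
    (∀ ρ, D.tree (s + 1) ρ = D.tree s ρ) ∨
    ∃ σ u p, p ≤ s ∧ σ.length = D.level p s ∧
      D.count p (D.tree s σ) < D.count p (D.tree s (σ ++ u)) ∧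
      ∀ ρ, D.tree (s + 1) ρ = D.tree s (substitute (σ, u) ρ) := by
  by_cases h : D.Acts s (D.moves s)
  · obtain ⟨h₁, h₂, h₃⟩ := (D.acts_iff (s := s) rfl).1 h
    exact .inr ⟨_, _, _, h₁, h₂, h₃, D.tree_succ_of_acts h⟩
  · exact .inl (D.tree_succ_of_not_acts h)

/-- The tree at a later stage is a subtree. -/
theorem exists_tree_eq {s t : ℕ} (h : s ≤ t) (ρ : List Bool) :
    ∃ ρ', ρ.length ≤ ρ'.length ∧ D.tree t ρ = D.tree s ρ' := by
  induction t, h using Nat.le_induction generalizing ρ with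
  | base => exact ⟨ρ, le_rfl, rfl⟩
  | succ t _ ih =>
    rcases D.tree_succ_cases t with h | ⟨σ, u, p, -, -, -, h⟩
    · rw [h]; exact ih ρ
    · obtain ⟨ρ', hl, he⟩ := ih (substitute (σ, u) ρ)
      exact ⟨ρ', (length_le_length_substitute _ _).trans hl, (h ρ).trans he⟩

/-! ### Convergence of the trees -/

/-- The total count of the tasks before `I`. -/
def totalCount (I : ℕ) (τ : List Bool) : ℕ :=
  ∑ p ∈ Finset.range I, D.count p τ

/-- A bound for the total count of the tasks before `I`. -/
def totalBound (I : ℕ) : ℕ :=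
  ∑ p ∈ Finset.range I, D.bound p

theorem totalCount_le (I : ℕ) (τ : List Bool) : D.totalCount I τ ≤ D.totalBound I :=
  Finset.sum_le_sum fun p _ => D.count_le_bound p τ

theorem totalCount_mono (I : ℕ) {τ τ' : List Bool} (h : τ <+: τ') :
    D.totalCount I τ ≤ D.totalCount I τ' :=
  Finset.sum_le_sum fun p _ => D.count_mono p h

theorem totalCount_lt {I p : ℕ} (hp : p < I) {τ τ' : List Bool} (h : τ <+: τ')
    (hlt : D.count p τ < D.count p τ') : D.totalCount I τ < D.totalCount I τ' :=
  Finset.sum_lt_sum (fun p _ => D.count_mono p h) ⟨p, Finset.mem_range.2 hp, hlt⟩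

/-- The strings of length at most `n` are eventually mapped to their limits. -/
theorem exists_tree_stable (n : ℕ) :
    ∃ s₀, ∀ s ≥ s₀, ∀ ρ, ρ.length ≤ n → D.tree s ρ = D.tree s₀ ρ := by
  obtain ⟨I, hI⟩ := D.exists_forall_lt_lvl n
  -- A level `m ≤ n` has at most `2 ^ n` nodes of weight at most `D.totalBound I`, so level weights
  -- are digits in base `E`.
  set E := 2 ^ n * D.totalBound I + 1 with hE
  set φ : ℕ → ℕ := fun s => horner E (levelWeight (D.totalCount I) (D.tree s)) n with hφ
  have hlt : ∀ s, ∀ m ≤ n, levelWeight (D.totalCount I) (D.tree s) m < E := fun s m hm =>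
    Nat.lt_succ_of_le ((levelWeight_le (D.totalCount_le I) _ m).trans
      (Nat.mul_le_mul_right _ (Nat.pow_le_pow_right (by norm_num) hm)))
  have hstep : ∀ s, φ s < φ (s + 1) ∨
      φ s = φ (s + 1) ∧ ∀ ρ, ρ.length ≤ n → D.tree (s + 1) ρ = D.tree s ρ := by
    intro s
    rcases D.tree_succ_cases s with h | ⟨σ, u, p, -, hσ, hc, h⟩
    · exact .inr ⟨by simp only [hφ, funext h], fun ρ _ => h ρ⟩
    · rcases Nat.lt_or_ge n σ.length with hn | hn
      · exact .inr ⟨horner_congr fun m hm => levelWeight_eq_of_lt h (hm.trans_lt hn), fun ρ hρ => by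
          rw [h, substitute_of_not_prefix (not_prefix_of_length_lt (hρ.trans_lt hn))]⟩
      · obtain ⟨j, hj, hl⟩ := D.exists_level_eq p s
        have hp : p < I := by
          by_contra hp
          have := hI j (by omega)
          omega
        exact .inl (horner_lt (hlt s) hn (fun m hm => levelWeight_eq_of_lt h hm)
          (levelWeight_lt_of_step h (D.totalCount_lt hp
            (D.tree_prefix s (List.prefix_append _ _)) hc)))
  have hmono : Monotone φ := monotone_nat_of_le_succ fun s => (hstep s).elim le_of_lt (·.1.le)
  obtain ⟨s₀, h₀⟩ := exists_forall_ge_eq_of_finite (f := φ) <|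
    (Set.finite_of_encard_le_coe (encard_setOf_lt_succ_le hmono
      fun s => horner_lt_pow (hlt s))).subset fun s hs => (hmono s.le_succ).lt_of_ne (Ne.symm hs)
  refine ⟨s₀, fun s hs => ?_⟩
  induction s, hs using Nat.le_induction with
  | base => exact fun _ _ => rfl
  | succ s hs ih =>
    intro ρ hρ
    rcases hstep s with h | h
    · rw [h₀ s hs, h₀ (s + 1) (by omega)] at h
      exact absurd h (lt_irrefl _)
    · rw [h.2 ρ hρ, ih ρ hρ]

/-- Eventually, the nodes at the level of a task maximize its counter. -/
theorem exists_count_maximal (p : ℕ) (N : ℕ) :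
    ∃ s₀, ∀ s ≥ s₀, ∀ σ u, σ.length = D.level p s → (σ ++ u).length ≤ N →
      D.count p (D.tree s (σ ++ u)) ≤ D.count p (D.tree s σ) := by
  obtain ⟨s₁, h₁⟩ := D.exists_level_stable p
  obtain ⟨s₂, h₂⟩ := D.exists_tree_stable N
  refine ⟨max s₁ s₂, fun s hs σ u hσ hu => ?_⟩
  by_contra! hlt
  -- The improving extension is requested again after everything has settled; granting it would
  -- change the count at a settled node.
  obtain ⟨t, ht, hr⟩ := exists_request_eq ((σ, u), p) (max p (max s₁ s₂))
  have hst : ∀ ρ, ρ.length ≤ N → D.tree s ρ = D.tree t ρ := fun ρ hρ => by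
    rw [h₂ s (by omega) ρ hρ, h₂ t (by omega) ρ hρ]
  have hσN : σ.length ≤ N := by simp at hu; omega
  rw [hst _ hu, hst _ hσN] at hlt
  have hact : D.Acts t (D.moves t) := (D.acts_iff hr).2
    ⟨by omega, by rw [hσ, h₁ s (by omega), h₁ t (by omega)], hlt⟩
  have h := D.tree_succ_of_acts hact σ
  have hsub := substitute_append (σ, u) []
  simp only [List.append_nil] at hsub
  rw [hr, hsub, h₂ (t + 1) (by omega) σ hσN, ← h₂ t (by omega) σ hσN] at h
  rw [h] at hlt
  exact lt_irrefl _ hlt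

/-! ### The class of paths -/

/-- The class of all paths through all trees `D.tree s`. -/
def paths : Set (ℕ → Bool) :=
  {Z | ∀ n s, ∃ σ, σ.length = n ∧ initialSegment Z n <+: D.tree s σ}

/-- The path follows the all-zero branch of the limit tree. It lies on every `tree s` because later
trees are subtrees of earlier ones. -/
theorem paths_nonempty : D.paths.Nonempty := by
  choose S hS using D.exists_tree_stable
  set R : ℕ → List Bool := fun n => D.tree (S n) (List.replicate n false) with hR
  have hRS : ∀ {n s}, S n ≤ s → R n = D.tree s (List.replicate n false) := fun {n s} h =>
    (hS n s h _ (by simp)).symm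
  have hlen : ∀ n, n ≤ (R n).length := fun n => by
    simpa using D.length_le_length_tree (S n) (List.replicate n false)
  have hpre : ∀ {m n}, m ≤ n → R m <+: R n := fun {m n} h => by
    rw [hRS (le_max_left (S m) (S n)), hRS (le_max_right (S m) (S n))]
    refine D.tree_prefix _ ⟨List.replicate (n - m) false, ?_⟩
    rw [← List.replicate_add, Nat.add_sub_cancel' h]
  refine ⟨fun k => (R (k + 1)).getD k false, fun n s => ?_⟩
  have hZ : initialSegment (fun k => (R (k + 1)).getD k false) n <+: R n := by
    rw [List.prefix_iff_eq_take]
    refine List.ext_getElem ?_ fun k h₁ h₂ => ?_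
    · simp [length_initialSegment, hlen]
    · have hk : k < n := by simpa [length_initialSegment] using h₁
      have hk' : k < (R (k + 1)).length := hlen (k + 1)
      have := (hpre (show k + 1 ≤ n from hk)).getElem hk'
      simp [initialSegment, List.getD, hk', this]
  obtain ⟨ρ, hl, he⟩ := D.exists_tree_eq (le_max_left s (S n)) (List.replicate n false)
  refine ⟨ρ.take n, by simpa using hl, ?_⟩
  rw [hRS (le_max_right s (S n)), he] at hZ
  refine List.prefix_of_prefix_length_le hZ (D.tree_prefix s (List.take_prefix n ρ)) ?_
  rw [length_initialSegment]
  exact le_trans (by simpa using hl) (D.length_le_length_tree s (ρ.take n))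

/-- The counters of a task along a path are eventually attained at the level of the task. -/
theorem exists_count_le_of_mem_paths {Z : ℕ → Bool} (hZ : Z ∈ D.paths) (p n : ℕ) :
    ∃ s₀, ∀ s ≥ s₀, ∃ σ k, σ.length = D.level p s ∧ D.tree s σ = initialSegment Z k ∧
      D.count p (initialSegment Z n) ≤ D.count p (D.tree s σ) := by
  obtain ⟨s₁, h₁⟩ := D.exists_level_stable p
  set l := D.level p s₁ with hl
  obtain ⟨s₂, h₂⟩ := D.exists_tree_stable l
  obtain ⟨M, hM⟩ : ∃ M, ∀ σ : List Bool, σ.length = l → (D.tree s₂ σ).length ≤ M := by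
    refine ⟨((strings l).map fun σ => (D.tree s₂ σ).length).sum, fun σ hσ => ?_⟩
    exact List.single_le_sum (by simp) _ (List.mem_map.2 ⟨σ, mem_strings.2 hσ, rfl⟩)
  -- Long enough to contain the given `n` bits and to reach past every node of the settled level
  -- `l`.
  set N := n + l + M with hN
  obtain ⟨s₃, h₃⟩ := D.exists_count_maximal p N
  refine ⟨s₁ + s₂ + s₃, fun s hs => ?_⟩
  obtain ⟨σ', hσ', hp⟩ := hZ N s
  have hσ : (σ'.take l).length = l := by simp; omega
  have htl : (D.tree s (σ'.take l)).length ≤ M := by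
    rw [h₂ s (by omega) _ hσ.le]
    exact hM _ hσ
  have hpre : D.tree s (σ'.take l) <+: initialSegment Z N :=
    List.prefix_of_prefix_length_le (D.tree_prefix s (List.take_prefix l σ')) hp
      (by rw [length_initialSegment]; omega)
  have hlev : D.level p s = l := h₁ s (by omega)
  refine ⟨σ'.take l, _, hσ.trans hlev.symm, eq_initialSegment_of_prefix hpre, ?_⟩
  calc D.count p (initialSegment Z n) ≤ D.count p (initialSegment Z N) :=
        D.count_mono p (initialSegment_prefix Z (by omega))
    _ ≤ D.count p (D.tree s σ') := D.count_mono p hp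
    _ ≤ _ := by
        have := h₃ s (by omega) (σ'.take l) (σ'.drop l) (hσ.trans hlev.symm) (by simp; omega)
        rwa [List.take_append_drop] at this

end Tasks

/-! ### Oracle computations on strings -/

/-- `G` computes `f` from initial segments of `A`: a primitive recursive function of strings,
monotone in the prefix order, whose values along `A` are those of `f`. -/
structure IsUseApproximation (A : ℕ → Bool) (f : ℕ →. ℕ) (G : List Bool → ℕ → Option ℕ) :
    Prop where
  primrec : Primrec₂ G
  mono : ∀ {τ τ' : List Bool} {x v : ℕ}, τ <+: τ' → G τ x = some v → G τ' x = some v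
  mem_iff : ∀ {x v : ℕ}, v ∈ f x ↔ ∃ n, G (initialSegment A n) x = some v

theorem IsUseApproximation.mono_initialSegment {A : ℕ → Bool} {f : ℕ →. ℕ}
    {G : List Bool → ℕ → Option ℕ} (h : IsUseApproximation A f G) {m n x v : ℕ} (hmn : m ≤ n)
    (hv : G (initialSegment A m) x = some v) : G (initialSegment A n) x = some v :=
  h.mono (initialSegment_prefix A hmn) hv

theorem exists_forall_lt_of_monotone {p : ℕ → ℕ → Prop} (hp : ∀ k {m n}, m ≤ n → p k m → p k n)
    {M : ℕ} (h : ∀ k < M, ∃ n, p k n) : ∃ n, ∀ k < M, p k n := by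
  induction M with
  | zero => exact ⟨0, fun k hk => absurd hk (Nat.not_lt_zero k)⟩
  | succ M ih =>
    obtain ⟨n₁, h₁⟩ := ih fun k hk => h k (by omega)
    obtain ⟨n₂, h₂⟩ := h M (by omega)
    refine ⟨max n₁ n₂, fun k hk => ?_⟩
    rcases Nat.lt_succ_iff_lt_or_eq.1 hk with hk | rfl
    · exact hp k (le_max_left _ _) (h₁ k hk)
    · exact hp k (le_max_right _ _) h₂

theorem isUseApproximation_of_primrec (A : ℕ → Bool) {f : ℕ → ℕ} (hf : Primrec f) :
    IsUseApproximation A (fun n => Part.some (f n)) fun _ x => some (f x) where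
  primrec := Primrec.option_some.comp (hf.comp Primrec.snd)
  mono _ h := h
  mem_iff := by simp [eq_comm]

theorem isUseApproximation_oracle (A : ℕ → Bool) :
    IsUseApproximation A (oracle A) fun τ x => τ[x]?.map Bool.toNat where
  primrec := Primrec.option_map Primrec.list_getElem? ((Primrec.dom_bool _).comp Primrec.snd)
  mono {τ τ' x v} h hv := by
    obtain ⟨ρ, rfl⟩ := h
    simp only [Option.map_eq_some_iff] at hv ⊢
    obtain ⟨b, hb, rfl⟩ := hv
    have := (List.getElem?_eq_some_iff.1 hb).1
    exact ⟨b, by rw [List.getElem?_append_left this, hb], rfl⟩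
  mem_iff {x v} := by
    simp only [oracle, Part.mem_some_iff, initialSegment]
    constructor
    · rintro rfl
      exact ⟨x + 1, by simp⟩
    · rintro ⟨n, hn⟩
      simp only [List.getElem?_map, Option.map_eq_some_iff] at hn
      obtain ⟨b, ⟨k, hk, rfl⟩, rfl⟩ := hn
      rw [List.getElem?_eq_some_iff] at hk
      obtain ⟨_, hk⟩ := hk
      simp at hk
      rw [hk]

namespace IsUseApproximation

variable {A : ℕ → Bool} {f h : ℕ →. ℕ} {F H : List Bool → ℕ → Option ℕ}

theorem pair (hf : IsUseApproximation A f F) (hh : IsUseApproximation A h H) :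
    IsUseApproximation A (fun n => Nat.pair <$> f n <*> h n)
      fun τ x => (F τ x).bind fun a => (H τ x).map (Nat.pair a) where
  primrec := Primrec.option_bind hf.primrec <| Primrec.option_map
    (hh.primrec.comp (Primrec.fst.comp Primrec.fst) (Primrec.snd.comp Primrec.fst))
    (Primrec₂.natPair.comp (Primrec.snd.comp Primrec.fst) Primrec.snd)
  mono {τ τ' x v} hp hv := by
    simp only [Option.bind_eq_some_iff, Option.map_eq_some_iff] at hv ⊢
    obtain ⟨a, ha, b, hb, rfl⟩ := hv
    exact ⟨a, hf.mono hp ha, b, hh.mono hp hb, rfl⟩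
  mem_iff {x v} := by
    simp only [Option.bind_eq_some_iff, Option.map_eq_some_iff, Seq.seq, Part.map_eq_map,
      Part.mem_bind_iff, Part.mem_map_iff, hf.mem_iff, hh.mem_iff]
    constructor
    · rintro ⟨_, ⟨a, ⟨n₁, h₁⟩, rfl⟩, b, ⟨n₂, h₂⟩, rfl⟩
      exact ⟨max n₁ n₂, a, hf.mono_initialSegment (le_max_left _ _) h₁, b,
        hh.mono_initialSegment (le_max_right _ _) h₂, rfl⟩
    · rintro ⟨n, a, ha, b, hb, rfl⟩
      exact ⟨_, ⟨a, ⟨n, ha⟩, rfl⟩, b, ⟨n, hb⟩, rfl⟩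

theorem comp (hf : IsUseApproximation A f F) (hh : IsUseApproximation A h H) :
    IsUseApproximation A (fun n => h n >>= f) fun τ x => (H τ x).bind (F τ) where
  primrec := Primrec.option_bind hh.primrec
    (hf.primrec.comp (Primrec.fst.comp Primrec.fst) Primrec.snd)
  mono {τ τ' x v} hp hv := by
    simp only [Option.bind_eq_some_iff] at hv ⊢
    obtain ⟨a, ha, hv⟩ := hv
    exact ⟨a, hh.mono hp ha, hf.mono hp hv⟩
  mem_iff {x v} := by
    have hb : v ∈ (h x).bind f ↔ ∃ a ∈ h x, v ∈ f a := Part.mem_bind_iff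
    refine hb.trans ?_
    simp only [Option.bind_eq_some_iff, hf.mem_iff, hh.mem_iff]
    constructor
    · rintro ⟨a, ⟨n₁, h₁⟩, ⟨n₂, h₂⟩⟩
      exact ⟨max n₁ n₂, a, hh.mono_initialSegment (le_max_left _ _) h₁,
        hf.mono_initialSegment (le_max_right _ _) h₂⟩
    · rintro ⟨n, a, ha, hv⟩
      exact ⟨a, ⟨n, ha⟩, ⟨n, hv⟩⟩

theorem prec (hf : IsUseApproximation A f F) (hh : IsUseApproximation A h H) :
    IsUseApproximation A
      (fun p => let (a, n) := Nat.unpair p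
        n.rec (f a) fun y IH => do
          let i ← IH
          h (Nat.pair a (Nat.pair y i)))
      fun τ p => Nat.rec (F τ p.unpair.1)
        (fun y IH => IH.bind fun i => H τ (Nat.pair p.unpair.1 (Nat.pair y i))) p.unpair.2 where
  primrec := by
    have hu : Primrec fun q : (List Bool × ℕ) => q.2.unpair.1 :=
      Primrec.fst.comp (Primrec.unpair.comp Primrec.snd)
    have hstep : Primrec₂ fun (q : List Bool × ℕ) (r : ℕ × Option ℕ) =>
        r.2.bind fun i => H q.1 (Nat.pair q.2.unpair.1 (Nat.pair r.1 i)) := by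
      refine Primrec.option_bind (Primrec.snd.comp Primrec.snd) ?_
      refine hh.primrec.comp (Primrec.fst.comp (Primrec.fst.comp Primrec.fst)) ?_
      exact Primrec₂.natPair.comp (hu.comp (Primrec.fst.comp Primrec.fst))
        (Primrec₂.natPair.comp (Primrec.fst.comp (Primrec.snd.comp Primrec.fst)) Primrec.snd)
    exact Primrec.nat_rec' (Primrec.snd.comp (Primrec.unpair.comp Primrec.snd))
      (hf.primrec.comp Primrec.fst hu) hstep
  mono {τ τ' x v} hp hv := by
    revert v
    generalize x.unpair.2 = n
    induction n with
    | zero => exact fun hv => hf.mono hp hv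
    | succ n ih =>
      intro v hv
      simp only [Option.bind_eq_some_iff] at hv ⊢
      obtain ⟨a, ha, hv⟩ := hv
      exact ⟨a, ih ha, hh.mono hp hv⟩
  mem_iff {x v} := by
    dsimp only
    revert v
    have hmono : ∀ (n : ℕ) {k l v : ℕ}, k ≤ l →
        (Nat.rec (F (initialSegment A k) x.unpair.1) (fun y IH => IH.bind fun i =>
          H (initialSegment A k) (Nat.pair x.unpair.1 (Nat.pair y i))) n : Option ℕ) = some v →
        (Nat.rec (F (initialSegment A l) x.unpair.1) (fun y IH => IH.bind fun i =>
          H (initialSegment A l) (Nat.pair x.unpair.1 (Nat.pair y i))) n : Option ℕ) = some v := by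
      intro n
      induction n with
      | zero => exact fun hkl hv => hf.mono_initialSegment hkl hv
      | succ n ih =>
        intro k l v hkl hv
        simp only [Option.bind_eq_some_iff] at hv ⊢
        obtain ⟨a, ha, hv⟩ := hv
        exact ⟨a, ih hkl ha, hh.mono_initialSegment hkl hv⟩
    generalize x.unpair.2 = n
    induction n with
    | zero => exact hf.mem_iff
    | succ n ih =>
      intro v
      refine Part.mem_bind_iff.trans ?_
      simp only [Option.bind_eq_some_iff, ih, hh.mem_iff]
      constructor
      · rintro ⟨a, ⟨n₁, h₁⟩, ⟨n₂, h₂⟩⟩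
        exact ⟨max n₁ n₂, a, hmono n (le_max_left _ _) h₁,
          hh.mono_initialSegment (le_max_right _ _) h₂⟩
      · rintro ⟨n, a, ha, hv⟩
        exact ⟨a, ⟨n, ha⟩, ⟨n, hv⟩⟩

/-- The least `n ≤ M` such that `o n` is not a positive number. -/
def firstNonpos (o : ℕ → Option ℕ) (M : ℕ) : ℕ :=
  (List.range M).findIdx fun n => decide ((o n).getD 0 = 0)

/-- An undefined value also stops the search, through the default 0, and is then rejected by the
test for `some 0`; hence the result persists when `o` becomes more defined. If nothing below `M`
stops the search, `M` itself is tested, whence `m ≤ M`. -/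
theorem firstNonpos_spec {o : ℕ → Option ℕ} {M m : ℕ} :
    (if o (firstNonpos o M) = some 0 then some (firstNonpos o M) else none) = some m ↔
      m ≤ M ∧ o m = some 0 ∧ ∀ k < m, ∃ v, o k = some (v + 1) := by
  have hpos : ∀ k < firstNonpos o M, ∃ v, o k = some (v + 1) := by
    intro k hk
    have := List.not_of_lt_findIdx hk
    simp only [List.getElem_range, decide_eq_false_iff_not] at this
    rcases ho : o k with _ | _ | v
    · simp [ho] at this
    · simp [ho] at this
    · exact ⟨v, rfl⟩
  constructor
  · intro h
    split_ifs at h with h0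
    obtain rfl : firstNonpos o M = m := by simpa using h
    have hle : firstNonpos o M ≤ (List.range M).length := List.findIdx_le_length
    exact ⟨by simpa using hle, h0, hpos⟩
  · rintro ⟨hm, h0, hlt⟩
    have : firstNonpos o M = m := by
      rcases lt_trichotomy (firstNonpos o M) m with h | h | h
      · obtain ⟨v, hv⟩ := hlt _ h
        have hM : firstNonpos o M < (List.range M).length := by simp; omega
        have hz : decide ((o (List.range M)[firstNonpos o M]).getD 0 = 0) = true :=
          List.findIdx_getElem (w := hM)
        simp [hv] at hz
      · exact h
      · obtain ⟨v, hv⟩ := hpos m h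
        simp [h0] at hv
    rw [this, if_pos h0]

theorem rfind (hf : IsUseApproximation A f F) :
    IsUseApproximation A
      (fun a => Nat.rfind fun n => (fun m => decide (m = 0)) <$> f (Nat.pair a n))
      fun τ a => if F τ (Nat.pair a (firstNonpos (fun n => F τ (Nat.pair a n)) τ.length)) = some 0
        then some (firstNonpos (fun n => F τ (Nat.pair a n)) τ.length) else none where
  primrec := by
    have hfirst : Primrec fun q : List Bool × ℕ =>
        firstNonpos (fun n => F q.1 (Nat.pair q.2 n)) q.1.length := by
      refine Primrec.list_findIdx (Primrec.list_range.comp (Primrec.list_length.comp Primrec.fst)) ?_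
      refine PrimrecPred.decide (p := fun r : (List Bool × ℕ) × ℕ =>
        (F r.1.1 (Nat.pair r.1.2 r.2)).getD 0 = 0) ?_
      refine Primrec.eq.comp (Primrec.option_getD.comp ?_ (Primrec.const 0)) (Primrec.const 0)
      exact hf.primrec.comp (Primrec.fst.comp Primrec.fst)
        (Primrec₂.natPair.comp (Primrec.snd.comp Primrec.fst) Primrec.snd)
    refine Primrec.ite (Primrec.eq.comp (hf.primrec.comp Primrec.fst
      (Primrec₂.natPair.comp Primrec.snd hfirst)) (Primrec.const _))
      (Primrec.option_some.comp hfirst) (Primrec.const none)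
  mono {τ τ' x v} hp hv := by
    have hiff := @firstNonpos_spec (fun n => F τ (Nat.pair x n)) τ.length v
    have hiff' := @firstNonpos_spec (fun n => F τ' (Nat.pair x n)) τ'.length v
    obtain ⟨h₁, h₂, h₃⟩ := hiff.1 hv
    refine hiff'.2 ⟨h₁.trans hp.length_le, hf.mono hp h₂, fun k hk => ?_⟩
    obtain ⟨v, hv⟩ := h₃ k hk
    exact ⟨v, hf.mono hp hv⟩
  mem_iff {x v} := by
    have hiff := fun n => @firstNonpos_spec
      (fun m => F (initialSegment A n) (Nat.pair x m)) (initialSegment A n).length v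
    have htrue : ∀ m, true ∈ (fun m => decide (m = 0)) <$> f (Nat.pair x m) ↔
        0 ∈ f (Nat.pair x m) := by simp
    have hfalse : ∀ m, false ∈ (fun m => decide (m = 0)) <$> f (Nat.pair x m) ↔
        ∃ v, v + 1 ∈ f (Nat.pair x m) := by
      intro m
      simp only [Part.map_eq_map, Part.mem_map_iff, decide_eq_false_iff_not]
      constructor
      · rintro ⟨a, ha, h0⟩
        exact ⟨a - 1, by rwa [Nat.sub_add_cancel (Nat.one_le_iff_ne_zero.2 h0)]⟩
      · rintro ⟨v, hv⟩
        exact ⟨_, hv, by simp⟩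
    refine Nat.mem_rfind.trans ?_
    rw [htrue]
    simp only [hfalse]
    constructor
    · rintro ⟨h0, hlt⟩
      obtain ⟨n₀, h0⟩ := hf.mem_iff.1 h0
      obtain ⟨n₁, h₁⟩ := exists_forall_lt_of_monotone (M := v)
        (p := fun k n => ∃ w, F (initialSegment A n) (Nat.pair x k) = some (w + 1))
        (fun k m n hmn ⟨w, hw⟩ => ⟨w, hf.mono_initialSegment hmn hw⟩)
        (fun k hk => by
          obtain ⟨w, hw⟩ := hlt hk
          obtain ⟨n, hn⟩ := hf.mem_iff.1 hw
          exact ⟨n, w, hn⟩)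
      refine ⟨v + n₀ + n₁, (hiff _).2 ⟨?_, hf.mono_initialSegment (by omega) h0, fun k hk => ?_⟩⟩
      · rw [length_initialSegment]; omega
      · obtain ⟨w, hw⟩ := h₁ k hk
        exact ⟨w, hf.mono_initialSegment (by omega) hw⟩
    · rintro ⟨n, hn⟩
      obtain ⟨-, h0, hlt⟩ := (hiff n).1 hn
      refine ⟨hf.mem_iff.2 ⟨n, h0⟩, fun {k} hk => ?_⟩
      obtain ⟨w, hw⟩ := hlt k hk
      exact ⟨w, hf.mem_iff.2 ⟨n, hw⟩⟩

end IsUseApproximation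

/-- Every function that is partial recursive in `A` is computed from initial segments of `A`. -/
theorem exists_isUseApproximation {A : ℕ → Bool} {f : ℕ →. ℕ}
    (hf : Nat.RecursiveIn {oracle A} f) : ∃ F, IsUseApproximation A f F := by
  induction hf with
  | zero => exact ⟨_, isUseApproximation_of_primrec A (Primrec.const 0)⟩
  | succ => exact ⟨_, isUseApproximation_of_primrec A Primrec.succ⟩
  | left => exact ⟨_, isUseApproximation_of_primrec A (Primrec.fst.comp Primrec.unpair)⟩
  | right => exact ⟨_, isUseApproximation_of_primrec A (Primrec.snd.comp Primrec.unpair)⟩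
  | oracle g hg =>
    obtain rfl : g = oracle A := hg
    exact ⟨_, isUseApproximation_oracle A⟩
  | pair _ _ hf hh =>
    obtain ⟨F, hF⟩ := hf
    obtain ⟨H, hH⟩ := hh
    exact ⟨_, hF.pair hH⟩
  | comp _ _ hf hh =>
    obtain ⟨F, hF⟩ := hf
    obtain ⟨H, hH⟩ := hh
    exact ⟨_, hF.comp hH⟩
  | prec _ _ hf hh =>
    obtain ⟨F, hF⟩ := hf
    obtain ⟨H, hH⟩ := hh
    exact ⟨_, hF.prec hH⟩
  | rfind _ hf =>
    obtain ⟨F, hF⟩ := hf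
    exact ⟨_, hF.rfind⟩

/-! ### Counting the changes of an approximation -/

/-- Update a state, consisting of a flag that is `true` as long as the approximation is defined,
a count of the values seen, and the current value. -/
def recordStep (q : Bool × ℕ × ℕ) (o : Option ℕ) : Bool × ℕ × ℕ :=
  o.elim (false, q.2) fun w =>
    if q.1 = true ∧ (q.2.1 = 0 ∨ q.2.2 ≠ w) then (true, q.2.1 + 1, w) else q

/-- The state reached after `t` values of a partial sequence. -/
def record (o : ℕ → Option ℕ) : ℕ → Bool × ℕ × ℕ
  | 0 => (true, 0, 0)
  | t + 1 => recordStep (record o t) (o t)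

theorem recordStep_count (q : Bool × ℕ × ℕ) (o : Option ℕ) :
    q.2.1 < (recordStep q o).2.1 ∨ (recordStep q o).2 = q.2 := by
  cases o with
  | none => exact .inr rfl
  | some w =>
    simp only [recordStep, Option.elim_some]
    split_ifs <;> simp

theorem record_count (o : ℕ → Option ℕ) {s t : ℕ} (h : s ≤ t) :
    (record o s).2.1 < (record o t).2.1 ∨ (record o t).2 = (record o s).2 := by
  induction t, h using Nat.le_induction with
  | base => exact .inr rfl
  | succ t _ ih =>
    rw [record]
    rcases recordStep_count (record o t) (o t) with h | h <;> rcases ih with h' | h'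
    · exact .inl (h'.trans h)
    · exact .inl (by rwa [← h'])
    · exact .inl (by rwa [h])
    · exact .inr (h.trans h')

theorem record_count_mono (o : ℕ → Option ℕ) {s t : ℕ} (h : s ≤ t) :
    (record o s).2.1 ≤ (record o t).2.1 :=
  (record_count o h).elim le_of_lt fun h => by rw [h]

theorem record_value_eq (o : ℕ → Option ℕ) {s t : ℕ} (h : s ≤ t)
    (hc : (record o t).2.1 ≤ (record o s).2.1) : (record o t).2.2 = (record o s).2.2 :=
  (record_count o h).elim (fun h => absurd h (not_lt.2 hc)) fun h => by rw [h]

/-- Recording freezes at the first undefined value, so a less defined sequence yields an earlier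
record of the more defined one. This gives monotonicity of the count under extension of the oracle
string. -/
theorem exists_record_eq {o o' : ℕ → Option ℕ} (h : ∀ t v, o t = some v → o' t = some v) (t : ℕ) :
    ∃ t₀ ≤ t, (record o t).2 = (record o' t₀).2 ∧
      ((record o t).1 = true → t₀ = t ∧ record o t = record o' t) := by
  induction t with
  | zero => exact ⟨0, le_rfl, rfl, fun _ => ⟨rfl, rfl⟩⟩
  | succ t ih =>
    obtain ⟨t₀, ht, he, ha⟩ := ih
    rcases ho : o t with _ | w
    · exact ⟨t₀, by omega, by simp [record, ho, recordStep, he], by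
        simp [record, ho, recordStep]⟩
    · by_cases hq : (record o t).1 = true
      · have : record o (t + 1) = record o' (t + 1) := by
          rw [record, record, ho, h t w ho, (ha hq).2]
        exact ⟨t + 1, le_rfl, by rw [this], fun _ => ⟨rfl, this⟩⟩
      · have : record o (t + 1) = record o t := by
          simp [record, ho, recordStep, hq]
        exact ⟨t₀, by omega, by rw [this, he], fun h' => absurd (this ▸ h') hq⟩

theorem record_congr {o o' : ℕ → Option ℕ} {t : ℕ} (h : ∀ k < t, o k = o' k) :
    record o t = record o' t := by
  induction t with
  | zero => rfl
  | succ t ih => rw [record, record, ih fun k hk => h k (by omega), h t (by omega)]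

theorem record_some (g : ℕ → ℕ) (t : ℕ) :
    (record (fun t => some (g t)) (t + 1)).1 = true ∧
    (record (fun t => some (g t)) (t + 1)).2.1 =
      1 + ((Finset.range t).filter fun k => g (k + 1) ≠ g k).card ∧
    (record (fun t => some (g t)) (t + 1)).2.2 = g t := by
  induction t with
  | zero => simp [record, recordStep]
  | succ t ih =>
    obtain ⟨h₁, h₂, h₃⟩ := ih
    rw [record]
    set q := record (fun t => some (g t)) (t + 1)
    rw [Finset.range_add_one, Finset.filter_insert]
    by_cases h : g (t + 1) = g t
    · simp [recordStep, h₁, h₃, h, h₂]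
    · have h' : ¬ g t = g (t + 1) := fun e => h e.symm
      simp [recordStep, h₁, h₃, h, h', h₂]
      omega

theorem primrec_recordStep : Primrec₂ recordStep := by
  refine Primrec.option_casesOn Primrec.snd
    (Primrec.pair (Primrec.const false) (Primrec.snd.comp Primrec.fst)) ?_ |>.of_eq
    (f := fun p : (Bool × ℕ × ℕ) × Option ℕ => Option.casesOn p.2 (false, p.1.2) fun w =>
      if p.1.1 = true ∧ (p.1.2.1 = 0 ∨ p.1.2.2 ≠ w) then (true, p.1.2.1 + 1, w) else p.1) ?_
  · have hq : Primrec fun r : ((Bool × ℕ × ℕ) × Option ℕ) × ℕ => r.1.1 :=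
      Primrec.fst.comp Primrec.fst
    have hc : Primrec fun r : ((Bool × ℕ × ℕ) × Option ℕ) × ℕ => r.1.1.2.1 :=
      Primrec.fst.comp (Primrec.snd.comp hq)
    have hv : Primrec fun r : ((Bool × ℕ × ℕ) × Option ℕ) × ℕ => r.1.1.2.2 :=
      Primrec.snd.comp (Primrec.snd.comp hq)
    exact Primrec.ite ((Primrec.eq.comp (Primrec.fst.comp hq) (Primrec.const true)).and
      ((Primrec.eq.comp hc (Primrec.const 0)).or (Primrec.eq.comp hv Primrec.snd).not))
      (Primrec.pair (Primrec.const true) (Primrec.pair (Primrec.succ.comp hc) Primrec.snd)) hq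
  · rintro ⟨q, _ | w⟩ <;> rfl

theorem primrec_record {α : Type*} [Primcodable α] {o : α → ℕ → Option ℕ} (ho : Primrec₂ o) :
    Primrec₂ fun a t => record (o a) t := by
  refine (Primrec.nat_rec (f := fun _ : α => (true, 0, 0))
    (g := fun a p => recordStep p.2 (o a p.1)) (Primrec.const _)
    (primrec_recordStep.comp (Primrec.snd.comp Primrec.snd)
      (ho.comp Primrec.fst (Primrec.fst.comp Primrec.snd)))).of_eq ?_
  intro a t
  induction t with
  | zero => rfl
  | succ t ih => rw [record, ← ih]

/-- A computable counter and a computable value, where the value depends on a string only as long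
as the counter changes, and the counter is computably bounded. -/
structure IsCounter (cnt val : ℕ → List Bool → ℕ) (bd : ℕ → ℕ) : Prop where
  computable_cnt : Computable₂ cnt
  computable_val : Computable₂ val
  computable_bd : Computable bd
  cnt_mono : ∀ x {τ τ' : List Bool}, τ <+: τ' → cnt x τ ≤ cnt x τ'
  val_eq : ∀ x {τ τ' : List Bool}, τ <+: τ' → cnt x τ = cnt x τ' → val x τ = val x τ'
  cnt_le : ∀ x τ, cnt x τ ≤ bd x

theorem exists_isCounter {A : ℕ → Bool} {f : ℕ → ℕ} (h : OmegaCEBy A f) :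
    ∃ cnt val bd, IsCounter cnt val bd ∧
      ∀ x, ∃ n₀, ∀ n ≥ n₀, val x (initialSegment A n) = f x := by
  obtain ⟨g, b, hg, hb, hgb⟩ := h
  obtain ⟨F, hF⟩ := exists_isUseApproximation hg
  have hmem : ∀ x t, ∃ n, F (initialSegment A n) (Nat.pair x t) = some (g x t) := fun x t =>
    hF.mem_iff.1 (by simp)
  have huniq : ∀ {n x t v}, F (initialSegment A n) (Nat.pair x t) = some v → v = g x t := by
    intro n x t v hv
    obtain ⟨m, hm⟩ := hmem x t
    have h₁ := hF.mono_initialSegment (le_max_left n m) hv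
    have h₂ := hF.mono_initialSegment (le_max_right n m) hm
    rw [h₁] at h₂
    exact Option.some_injective _ h₂
  set R : ℕ → List Bool → Bool × ℕ × ℕ :=
    fun x τ => record (fun t => F τ (Nat.pair x t)) τ.length with hR
  have hRprim : Primrec₂ R := by
    have ho : Primrec₂ fun (q : ℕ × List Bool) t => F q.2 (Nat.pair q.1 t) :=
      hF.primrec.comp (Primrec.snd.comp Primrec.fst)
        (Primrec₂.natPair.comp (Primrec.fst.comp Primrec.fst) Primrec.snd)
    exact (primrec_record ho).comp Primrec.id (Primrec.list_length.comp Primrec.snd)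
  have hcnt : Primrec₂ fun x τ => (R x τ).2.1 := Primrec.fst.comp (Primrec.snd.comp hRprim)
  have hval : Primrec₂ fun x τ => (R x τ).2.2 := Primrec.snd.comp (Primrec.snd.comp hRprim)
  have hbd : Computable fun x => b x + 2 := Computable.succ.comp (Computable.succ.comp hb)
  have hmono : ∀ x {τ τ' : List Bool}, τ <+: τ' → (R x τ).2.1 ≤ (R x τ').2.1 ∧
      ((R x τ').2.1 ≤ (R x τ).2.1 → (R x τ').2.2 = (R x τ).2.2) := by
    intro x τ τ' hp
    obtain ⟨t₀, ht, he, -⟩ := exists_record_eq (o := fun t => F τ (Nat.pair x t))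
      (o' := fun t => F τ' (Nat.pair x t)) (fun t v => hF.mono hp) τ.length
    simp only [hR, he]
    exact ⟨record_count_mono _ (ht.trans hp.length_le),
      record_value_eq _ (ht.trans hp.length_le)⟩
  -- Along `A` at most `b x + 1` values are recorded (the first one and the changes), so the cap is
  -- not reached. Other strings may exceed it; the value 0 at the cap keeps the value constant while
  -- the capped count is.
  refine ⟨fun x τ => min (R x τ).2.1 (b x + 2),
    fun x τ => if (R x τ).2.1 < b x + 2 then (R x τ).2.2 else 0, fun x => b x + 2,
    ⟨?_, ?_, hbd, ?_, ?_, fun _ _ => min_le_right _ _⟩, ?_⟩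
  · exact Primrec.nat_min.to_comp.comp hcnt.to_comp (hbd.comp Computable.fst)
  · exact (Computable.cond (Primrec.nat_lt.decide.to_comp.comp hcnt.to_comp
      (hbd.comp Computable.fst)) hval.to_comp (Computable.const 0)).of_eq fun p => by
        by_cases h : (R p.1 p.2).2.1 < b p.1 + 2 <;> simp [h]
  · exact fun x τ τ' hp => min_le_min_right _ (hmono x hp).1
  · intro x τ τ' hp he
    obtain ⟨h₁, h₂⟩ := hmono x hp
    by_cases h : (R x τ').2.1 < b x + 2
    · have : (R x τ').2.1 = (R x τ).2.1 := by omega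
      rw [if_pos h, if_pos (by omega), h₂ this.le]
    · rw [if_neg h, if_neg (by omega)]
  · intro x
    obtain ⟨hlim, hch⟩ := hgb x
    obtain ⟨T, hT⟩ := Filter.eventually_atTop.1 hlim
    set o' : ℕ → Option ℕ := fun t => some (g x t) with ho'
    have hbound : ∀ t, (record o' t).2.1 ≤ b x + 1 := by
      intro t
      cases t with
      | zero => simp [record]
      | succ t =>
        rw [(record_some (g x) t).2.1]
        have : (((Finset.range t).filter fun k => g x (k + 1) ≠ g x k).card : ℕ∞) ≤ b x := by
          rw [← Set.encard_coe_eq_coe_finsetCard]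
          refine le_trans (Set.encard_le_encard fun k hk => ?_) hch
          simp only [Finset.coe_filter, Set.mem_ofPred_eq] at hk
          exact hk.2
        have := Nat.cast_le.1 this
        omega
    have hvalue : ∀ t > T, (record o' t).2.2 = f x := by
      intro t ht
      obtain ⟨t, rfl⟩ : ∃ k, t = k + 1 := ⟨t - 1, by omega⟩
      rw [(record_some (g x) t).2.2, hT t (by omega)]
    obtain ⟨n₁, h₁⟩ := exists_forall_lt_of_monotone (M := T + 1)
      (p := fun t n => F (initialSegment A n) (Nat.pair x t) = some (g x t))
      (fun t m n hmn h => hF.mono_initialSegment hmn h) (fun t _ => hmem x t)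
    refine ⟨n₁ + T + 1, fun n hn => ?_⟩
    set o : ℕ → Option ℕ := fun t => F (initialSegment A n) (Nat.pair x t) with ho
    obtain ⟨t₀, ht₀, he, -⟩ := exists_record_eq (o := o) (o' := o')
      (fun t v hv => by rw [ho', huniq hv]) n
    have hRn : R x (initialSegment A n) = record o n := by
      simp only [hR, length_initialSegment, ho]
    have hearly : record o (T + 1) = record o' (T + 1) :=
      record_congr fun k hk => hF.mono_initialSegment (by omega) (h₁ k hk)
    dsimp only
    rw [hRn, he, if_pos (by have := hbound t₀; omega)]
    rcases Nat.lt_or_ge T t₀ with h | h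
    · exact hvalue t₀ h
    -- Here the record at `t₀` already has the count reached at `T + 1`, hence also the same value.
    · rw [← record_value_eq o' (show t₀ ≤ T + 1 by omega), hvalue _ (by omega)]
      rw [← hearly, ← he]
      exact record_count_mono o (by omega)

/-! ### Effectiveness of the construction -/

theorem primrec_strings : Primrec strings := by
  have hstep : Primrec₂ fun (_ : ℕ) (l : List (List Bool)) =>
      l.map (List.cons false) ++ l.map (List.cons true) :=
    Primrec.list_append.comp
      (Primrec.list_map Primrec.snd (Primrec.list_cons.comp (Primrec.const false) Primrec.snd))
      (Primrec.list_map Primrec.snd (Primrec.list_cons.comp (Primrec.const true) Primrec.snd))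
  refine (Primrec.nat_rec₁ [[]] hstep).of_eq fun n => ?_
  induction n with
  | zero => rfl
  | succ n ih => rw [strings, ← ih]

theorem primrec_substitute : Primrec₂ substitute := by
  have h₁ : Primrec fun p : (List Bool × List Bool) × List Bool => p.1.1 :=
    Primrec.fst.comp Primrec.fst
  have hl := Primrec.list_length.comp h₁
  exact Primrec.ite (Primrec.eq.comp (Primrec.list_take.comp hl Primrec.snd) h₁)
    (Primrec.list_append.comp (Primrec.list_append.comp h₁ (Primrec.snd.comp Primrec.fst))
      (Primrec.list_drop.comp hl Primrec.snd)) Primrec.snd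

theorem primrec_applyMoves : Primrec₂ applyMoves :=
  Primrec.list_foldl Primrec.fst Primrec.snd (primrec_substitute.comp
    (Primrec.snd.comp Primrec.snd) (Primrec.fst.comp Primrec.snd)).to₂

namespace Tasks

variable {D : Tasks}

theorem primrec_level (hl : Primrec D.lvl) : Primrec₂ D.level := by
  have h : Primrec₂ fun (q : ℕ × ℕ) (r : ℕ × ℕ) => min r.2 (D.lvl (q.1 + r.1 + 1)) :=
    Primrec.nat_min.comp (Primrec.snd.comp Primrec.snd) (hl.comp (Primrec.succ.comp
      (Primrec.nat_add.comp (Primrec.fst.comp Primrec.fst) (Primrec.fst.comp Primrec.snd))))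
  exact Primrec.nat_rec' (Primrec.nat_sub.comp Primrec.snd Primrec.fst) (hl.comp Primrec.fst) h

theorem primrec_request : Primrec request :=
  Primrec.option_getD.comp (Primrec.decode.comp (Primrec.fst.comp Primrec.unpair))
    (Primrec.const _)

theorem primrec_acts (hl : Primrec D.lvl) (hc : Primrec₂ D.count) :
    PrimrecRel fun s l => D.Acts s l := by
  have hr : Primrec fun q : ℕ × List (List Bool × List Bool) => request q.1 :=
    primrec_request.comp Primrec.fst
  have hp := Primrec.snd.comp hr
  have hσ := Primrec.fst.comp (Primrec.fst.comp hr)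
  have hu := Primrec.snd.comp (Primrec.fst.comp hr)
  exact (Primrec.nat_le.comp hp Primrec.fst).and
    ((Primrec.eq.comp (Primrec.list_length.comp hσ) ((primrec_level hl).comp hp Primrec.fst)).and
      (Primrec.nat_lt.comp (hc.comp hp (primrec_applyMoves.comp Primrec.snd hσ))
        (hc.comp hp (primrec_applyMoves.comp Primrec.snd (Primrec.list_append.comp hσ hu)))))

theorem primrec_moves (hl : Primrec D.lvl) (hc : Primrec₂ D.count) : Primrec D.moves := by
  have hstep : Primrec₂ fun (s : ℕ) (l : List (List Bool × List Bool)) =>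
      if D.Acts s l then (request s).1 :: l else l :=
    Primrec.ite (primrec_acts hl hc) (Primrec.list_cons.comp
      (Primrec.fst.comp (primrec_request.comp Primrec.fst)) Primrec.snd) Primrec.snd
  refine (Primrec.nat_rec₁ [] hstep).of_eq fun n => ?_
  induction n with
  | zero => rfl
  | succ n ih => rw [moves, ← ih]

theorem primrec_tree (hl : Primrec D.lvl) (hc : Primrec₂ D.count) : Primrec₂ D.tree :=
  primrec_applyMoves.comp ((primrec_moves hl hc).comp Primrec.fst) Primrec.snd

theorem isPi01Class_paths (hl : Primrec D.lvl) (hc : Primrec₂ D.count) :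
    IsPi01Class D.paths := by
  set Q : List Bool → ℕ → Bool :=
    fun τ s => decide (∀ σ ∈ strings τ.length, ¬ (D.tree s σ).take τ.length = τ) with hQ
  have hQprim : Primrec₂ Q := by
    have hR : PrimrecRel fun (σ : List Bool) (q : List Bool × ℕ) =>
        ¬ (D.tree q.2 σ).take q.1.length = q.1 :=
      (Primrec.eq.comp (Primrec.list_take.comp
        (Primrec.list_length.comp (Primrec.fst.comp Primrec.snd))
        ((primrec_tree hl hc).comp (Primrec.snd.comp Primrec.snd) Primrec.fst))
        (Primrec.fst.comp Primrec.snd)).not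
    exact (hR.forall_mem_list.comp (primrec_strings.comp
      (Primrec.list_length.comp Primrec.fst)) Primrec.id).decide
  refine ⟨{τ | ∃ s, Q τ s = true}, ?_, ?_⟩
  · have hdom := (Partrec.rfind (p := fun τ s => Part.some (Q τ s)) hQprim.to_comp).dom_re
    refine hdom.of_eq fun τ => ?_
    refine Nat.rfind_dom'.trans ?_
    simp [Part.some_dom]
  · ext Z
    have hZ : Z ∈ openClass {τ | ∃ s, Q τ s = true} ↔
        ∃ n s, ∀ σ : List Bool, σ.length = n → ¬ initialSegment Z n <+: D.tree s σ := by
      simp only [openClass, Set.mem_ofPred_eq, hQ, decide_eq_true_eq, length_initialSegment,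
        mem_strings]
      refine exists_congr fun n => exists_congr fun s => forall_congr' fun σ =>
        imp_congr_right fun _ => not_congr ?_
      rw [List.prefix_iff_eq_take, length_initialSegment, eq_comm]
    rw [Set.mem_compl_iff, hZ, paths, Set.mem_ofPred_eq]
    push Not
    rfl

end Tasks

theorem computable_list_map {α β γ : Type*} [Primcodable α] [Primcodable β] [Primcodable γ]
    {l : α → List β} {g : α → β → γ} (hl : Computable l) (hg : Computable₂ g) :
    Computable fun a => (l a).map (g a) := by
  have hstep : Computable₂ fun (a : α) (p : ℕ × List γ) =>
      p.2 ++ (((l a)[p.1]?).map fun b => [g a b]).getD [] := by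
    refine Computable.list_append.comp (Computable.snd.comp Computable.snd)
      (Computable.option_getD (Computable.option_map ?_ ?_) (Computable.const []))
    · exact Computable.list_getElem?.comp (hl.comp Computable.fst)
        (Computable.fst.comp Computable.snd)
    · exact Computable.list_cons.comp
        (hg.comp (Computable.fst.comp Computable.fst) Computable.snd) (Computable.const [])
  refine (Computable.nat_rec (Computable.list_length.comp hl) (Computable.const []) hstep).of_eq
    fun a => ?_
  have h : ∀ n, (Nat.rec [] (fun k acc => acc ++ (((l a)[k]?).map fun b => [g a b]).getD []) n :
      List γ) = ((l a).take n).map (g a) := by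
    intro n
    induction n with
    | zero => simp
    | succ n ih =>
      rw [List.take_add_one, List.map_append, ← ih]
      rcases hn : (l a)[n]? with _ | b <;> simp [hn]
  refine (h (l a).length).trans ?_
  rw [List.take_length]

theorem primrec_pow : Primrec₂ ((· ^ ·) : ℕ → ℕ → ℕ) :=
  Primrec₂.unpaired'.1 Nat.Primrec.pow

/-- Currying a code for membership in a coded list (the s-m-n theorem) gives the index computably.
-/
theorem exists_index_of_list :
    ∃ idx : List ℕ → ℕ, Computable idx ∧ ∀ l, W (idx l) = {v | v ∈ l} := by
  have hmem : PrimrecRel fun (l : List ℕ) (v : ℕ) => ∃ a ∈ l, a = v :=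
    Primrec.eq.exists_mem_list
  have hdec : Primrec fun n : ℕ => (decode n.unpair.1 : Option (List ℕ)).getD [] :=
    Primrec.option_getD.comp (Primrec.decode.comp (Primrec.fst.comp Primrec.unpair))
      (Primrec.const _)
  have hF : Primrec fun n : ℕ =>
      if ∃ a ∈ (decode n.unpair.1 : Option (List ℕ)).getD [], a = n.unpair.2
      then some 0 else (none : Option ℕ) :=
    Primrec.ite (hmem.comp hdec (Primrec.snd.comp Primrec.unpair)) (Primrec.const _)
      (Primrec.const _)
  obtain ⟨c, hc⟩ := Nat.Partrec.Code.exists_code.1 (Partrec.nat_iff.1 hF.to_comp.ofOption)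
  refine ⟨fun l => encode (c.curry (encode l)), ?_, fun l => ?_⟩
  · exact (Primrec.encode.comp (Nat.Partrec.Code.primrec₂_curry.comp (Primrec.const c)
      Primrec.encode)).to_comp
  · ext v
    simp only [W, Denumerable.ofNat_encode, Set.mem_ofPred_eq, Nat.Partrec.Code.eval_curry, hc,
      Nat.unpair_pair, encodek, Option.getD_some, exists_eq_right]
    split_ifs with h <;> simp [h]

/-! ### Traces from the values at the nodes of a level -/

namespace Tasks

variable {D : Tasks}

theorem computable_totalBound (hb : Computable D.bound) : Computable D.totalBound := by
  have hstep : Computable₂ fun (_ : ℕ) (p : ℕ × ℕ) => p.2 + D.bound p.1 :=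
    Primrec.nat_add.to_comp.comp (Computable.snd.comp Computable.snd)
      (hb.comp (Computable.fst.comp Computable.snd))
  refine (Computable.nat_rec Computable.id (Computable.const 0) hstep).of_eq fun n => ?_
  induction n with
  | zero => rfl
  | succ n ih => rw [totalBound, Finset.sum_range_succ, ← totalBound, ← ih]; rfl

/-- The values at the nodes where the task `p` is active at stage `s`. -/
def nodeValues (D : Tasks) (val : List Bool → ℕ) (p s : ℕ) : List ℕ :=
  (strings (D.level p s)).map fun σ => val (D.tree s σ)

theorem length_nodeValues (val : List Bool → ℕ) (p s : ℕ) :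
    (D.nodeValues val p s).length = 2 ^ D.level p s := by
  rw [nodeValues, List.length_map, length_strings]

/-- A bound for the number of changes of the node values of a task on level at most `x`. -/
def changeBound (D : Tasks) (x b p : ℕ) : ℕ :=
  (x + 1) * (2 ^ x * (b + D.totalBound p) + 1) ^ (x + 1)

theorem encard_nodeValues_changes_le {cnt val : List Bool → ℕ} {x b p : ℕ}
    (hmono : ∀ {τ τ' : List Bool}, τ <+: τ' → cnt τ ≤ cnt τ')
    (hval : ∀ {τ τ' : List Bool}, τ <+: τ' → cnt τ = cnt τ' → val τ = val τ')
    (hb : ∀ τ, cnt τ ≤ b) (hp : D.lvl p ≤ x) :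
    {s | D.nodeValues val p (s + 1) ≠ D.nodeValues val p s}.encard ≤ D.changeBound x b p := by
  set w : List Bool → ℕ := fun τ => cnt τ + D.totalCount p τ with hw
  set E := 2 ^ x * (b + D.totalBound p) + 1 with hE
  set l : ℕ → ℕ := D.level p with hl
  have hlx : ∀ s, l s ≤ x := fun s => (D.level_le_lvl p s).trans hp
  -- The leading part records drops of the level: each adds at least `E ^ (x + 1)`, more than the
  -- Horner part can lose. Within a fixed level, the Horner part compares level weights
  -- lexicographically.
  set φ : ℕ → ℕ := fun s =>
    (x - l s) * E ^ (x + 1) + horner E (levelWeight w (D.tree s)) (l s) with hφ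
  have hwE : ∀ s, ∀ m ≤ x, levelWeight w (D.tree s) m < E := fun s m hm =>
    Nat.lt_succ_of_le ((levelWeight_le (b := b + D.totalBound p)
      (fun τ => Nat.add_le_add (hb τ) (D.totalCount_le p τ)) _ m).trans
      (Nat.mul_le_mul_right _ (Nat.pow_le_pow_right (by norm_num) hm)))
  have hhorner : ∀ s, horner E (levelWeight w (D.tree s)) (l s) < E ^ (x + 1) := fun s =>
    (horner_lt_pow fun m hm => hwE s m (hm.trans (hlx s))).trans_le
      (Nat.pow_le_pow_right (by omega) (Nat.succ_le_succ (hlx s)))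
  have hφlt : ∀ s, φ s < D.changeBound x b p := fun s => by
    have h₁ : (x - l s) * E ^ (x + 1) ≤ x * E ^ (x + 1) := Nat.mul_le_mul_right _ (Nat.sub_le _ _)
    have h₂ := hhorner s
    rw [changeBound, Nat.succ_mul]
    exact Nat.add_lt_add_of_le_of_lt h₁ h₂
  have hstep : ∀ s, φ s < φ (s + 1) ∨
      φ s ≤ φ (s + 1) ∧ D.nodeValues val p (s + 1) = D.nodeValues val p s := by
    intro s
    rcases (D.level_antitone p s.le_succ).lt_or_eq with hlt | heq
    · left
      have h₁ : (x - l s + 1) * E ^ (x + 1) ≤ (x - l (s + 1)) * E ^ (x + 1) :=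
        Nat.mul_le_mul_right _ (by
          have := hlx s
          have : l (s + 1) < l s := hlt
          omega)
      have h₂ := hhorner s
      rw [Nat.succ_mul] at h₁
      simp only [hφ]
      omega
    · change l (s + 1) = l s at heq
      simp only [hφ, heq, nodeValues, ← hl]
      rcases D.tree_succ_cases s with h | ⟨σ, u, q, hqs, hσ, hc, h⟩
      · exact .inr ⟨by rw [funext h], by simp only [h]⟩
      have hpre := D.tree_prefix s (List.prefix_append σ u)
      have hwE' : ∀ m ≤ l s, levelWeight w (D.tree s) m < E := fun m hm =>
        hwE s m (hm.trans (hlx s))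
      rcases lt_trichotomy σ.length (l s) with hlt | hleq | hgt
      · left
        -- A move above the level of `p` comes from an earlier task, whose counter is included in
        -- the weight `w`.
        have hqp : q < p := by
          by_contra hqp
          have : l s ≤ D.level q s := D.level_mono_left (not_lt.1 hqp) hqs
          omega
        exact Nat.add_lt_add_left (horner_lt hwE' hlt.le (fun m hm => levelWeight_eq_of_lt h hm)
          (levelWeight_lt_of_step h
            (Nat.add_lt_add_of_le_of_lt (hmono hpre) (D.totalCount_lt hqp hpre hc)))) _
      · rcases (hmono hpre).lt_or_eq with hcnt | hcnt
        · left
          exact Nat.add_lt_add_left (horner_lt hwE' hleq.le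
            (fun m hm => levelWeight_eq_of_lt h hm) (levelWeight_lt_of_step h
              (Nat.add_lt_add_of_lt_of_le hcnt (D.totalCount_mono p hpre)))) _
        -- A move at the level itself that does not raise `cnt` leaves the value unchanged, so no
        -- strict increase of the potential is needed.
        · right
          constructor
          · rw [← hleq]
            exact Nat.add_le_add_left (horner_le_of_last (fun m hm => levelWeight_eq_of_lt h hm)
              (levelWeight_le_of_step h
                (Nat.add_le_add (hmono hpre) (D.totalCount_mono p hpre)))) _
          · refine List.map_congr_left fun ρ hρ => ?_
            rw [h]
            by_cases hρσ : σ <+: ρ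
            · obtain rfl := hρσ.eq_of_length (hleq.trans (mem_strings.1 hρ).symm)
              have := substitute_append (σ, u) []
              simp only [List.append_nil] at this
              rw [this, hval hpre hcnt]
            · rw [substitute_of_not_prefix hρσ]
      · right
        refine ⟨(Nat.add_left_cancel_iff.2 (horner_congr fun m hm =>
          levelWeight_eq_of_lt h (hm.trans_lt hgt))).le, List.map_congr_left fun ρ hρ => ?_⟩
        rw [h, substitute_of_not_prefix (not_prefix_of_length_lt ((mem_strings.1 hρ).trans_lt hgt))]
  refine le_trans (Set.encard_le_encard fun s hs => ?_) (encard_setOf_lt_succ_le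
    (monotone_nat_of_le_succ fun s => (hstep s).elim le_of_lt (·.1)) hφlt)
  exact (hstep s).resolve_right fun h => hs h.2

theorem computable_nodeValues (hl : Primrec D.lvl) (hc : Primrec₂ D.count)
    {val : ℕ → List Bool → ℕ} (hval : Computable₂ val) {idx : ℕ → ℕ} (hidx : Computable idx) :
    Computable₂ fun x s => D.nodeValues (val x) (idx x) s :=
  computable_list_map
    (primrec_strings.to_comp.comp
      ((primrec_level hl).to_comp.comp (hidx.comp Computable.fst) Computable.snd))
    (hval.comp (Computable.fst.comp Computable.fst)
      ((primrec_tree hl hc).to_comp.comp (Computable.snd.comp Computable.fst) Computable.snd))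

theorem computable_changeBound (hb : Computable D.bound) {bd idx : ℕ → ℕ} (hbd : Computable bd)
    (hidx : Computable idx) : Computable fun x => D.changeBound x (bd x) (idx x) :=
  Primrec.nat_mul.to_comp.comp Computable.succ (primrec_pow.to_comp.comp
    (Computable.succ.comp (Primrec.nat_mul.to_comp.comp
      (primrec_pow.to_comp.comp (Computable.const 2) Computable.id)
      (Primrec.nat_add.to_comp.comp hbd ((computable_totalBound hb).comp hidx))))
    Computable.succ)

/-- A node on `Z` with maximal count has at least the count of an initial segment where the value
has reached its limit. If the node is shorter than that segment, the counts agree and hence so do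
the values. -/
theorem exists_mem_nodeValues {Z : ℕ → Bool} (hZ : Z ∈ D.paths) {cnt val : List Bool → ℕ} {p v : ℕ}
    (hmono : ∀ {τ τ' : List Bool}, τ <+: τ' → cnt τ ≤ cnt τ')
    (hval : ∀ {τ τ' : List Bool}, τ <+: τ' → cnt τ = cnt τ' → val τ = val τ')
    (hlim : ∃ n₀, ∀ n ≥ n₀, val (initialSegment Z n) = v)
    (hle : ∀ τ, D.count p τ ≤ cnt τ)
    (hge : ∀ n, ∃ m, cnt (initialSegment Z n) ≤ D.count p (initialSegment Z m)) :
    ∃ s₀, ∀ s ≥ s₀, v ∈ D.nodeValues val p s := by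
  obtain ⟨n₀, hn₀⟩ := hlim
  obtain ⟨m, hm⟩ := hge n₀
  obtain ⟨s₀, hs₀⟩ := D.exists_count_le_of_mem_paths hZ p m
  refine ⟨s₀, fun s hs => ?_⟩
  obtain ⟨σ, k, hσ, hk, hc⟩ := hs₀ s hs
  refine List.mem_map.2 ⟨σ, mem_strings.2 hσ, ?_⟩
  have hcnt : cnt (initialSegment Z n₀) ≤ cnt (initialSegment Z k) :=
    hk ▸ hm.trans (hc.trans (hle _))
  rw [hk]
  rcases le_total n₀ k with h | h
  · exact hn₀ k h
  · rw [hval (initialSegment_prefix Z h)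
      (le_antisymm (hmono (initialSegment_prefix Z h)) hcnt), hn₀ n₀ le_rfl]

theorem hasBLRTraceWithBound (hl : Primrec D.lvl) (hc : Primrec₂ D.count)
    (hb : Computable D.bound) {Z : ℕ → Bool} (hZ : Z ∈ D.paths) {cnt val : ℕ → List Bool → ℕ}
    {bd f : ℕ → ℕ} (h : IsCounter cnt val bd)
    (hlim : ∀ x, ∃ n₀, ∀ n ≥ n₀, val x (initialSegment Z n) = f x)
    {idx : ℕ → ℕ} (hidx : Computable idx) {x₀ : ℕ} (hlvl : ∀ x ≥ x₀, D.lvl (idx x) ≤ x)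
    (hle : ∀ x ≥ x₀, ∀ τ, D.count (idx x) τ ≤ cnt x τ)
    (hge : ∀ x ≥ x₀, ∀ n, ∃ m,
      cnt x (initialSegment Z n) ≤ D.count (idx x) (initialSegment Z m)) :
    HasBLRTraceWithBound f fun n => 2 ^ n := by
  obtain ⟨ind, hind, hW⟩ := exists_index_of_list
  -- The finitely many arguments below `x₀`, where no task is available, receive the correct value
  -- outright.
  set V : ℕ → ℕ → List ℕ := fun x s =>
    ((((List.range x₀).map f)[x]?).map fun v => [v]).getD (D.nodeValues (val x) (idx x) s) with hV
  have hVcomp : Computable₂ V := by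
    refine Computable.option_getD (Computable.option_map
      (Computable.list_getElem?.comp (Computable.const _) Computable.fst) ?_)
      (computable_nodeValues hl hc h.computable_val hidx)
    exact Computable.list_cons.comp Computable.snd (Computable.const [])
  have hVlt : ∀ x < x₀, ∀ s, V x s = [f x] := fun x hx s => by simp [hV, hx]
  have hVge : ∀ x ≥ x₀, ∀ s, V x s = D.nodeValues (val x) (idx x) s := fun x hx s => by
    simp [hV, hx]
  have hlen : ∀ x s, (V x s).length ≤ 2 ^ x := fun x s => by
    rcases Nat.lt_or_ge x x₀ with hx | hx
    · simpa [hVlt x hx] using Nat.one_le_two_pow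
    · rw [hVge x hx, length_nodeValues]
      exact Nat.pow_le_pow_right (by norm_num) ((D.level_le_lvl _ s).trans (hlvl x hx))
  have hmem : ∀ x, ∃ s₀, ∀ s ≥ s₀, f x ∈ V x s := fun x => by
    rcases Nat.lt_or_ge x x₀ with hx | hx
    · exact ⟨0, fun s _ => by simp [hVlt x hx]⟩
    · obtain ⟨s₀, hs₀⟩ := exists_mem_nodeValues hZ (h.cnt_mono x) (h.val_eq x) (hlim x)
        (hle x hx) (hge x hx)
      exact ⟨s₀, fun s hs => by rw [hVge x hx]; exact hs₀ s hs⟩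
  have hch : ∀ x, {s | V x (s + 1) ≠ V x s}.encard ≤ D.changeBound x (bd x) (idx x) := fun x => by
    rcases Nat.lt_or_ge x x₀ with hx | hx
    · simp [hVlt x hx]
    · simp only [hVge x hx]
      exact encard_nodeValues_changes_le (h.cnt_mono x) (h.val_eq x) (h.cnt_le x) (hlvl x hx)
  have hconst : ∀ x, ∃ s₀, ∀ s ≥ s₀, V x s = V x s₀ := fun x =>
    exists_forall_ge_eq_of_finite (Set.finite_of_encard_le_coe (hch x))
  choose S hS using hconst
  refine ⟨fun x => W (ind (V x (S x))), ⟨fun x => ind (V x (S x)), ⟨fun x s => ind (V x s),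
    fun x => D.changeBound x (bd x) (idx x), hind.comp hVcomp,
    computable_changeBound hb h.computable_bd hidx, fun x => ⟨?_, ?_⟩⟩, fun _ => rfl⟩,
    fun x => ?_, fun x => ?_⟩
  · exact Filter.eventually_atTop.2 ⟨S x, fun s hs => congrArg ind (hS x s hs)⟩
  · exact (Set.encard_le_encard fun s (hs : ind _ ≠ ind _) hV' => hs (congrArg ind hV')).trans (hch x)
  · have : {v | v ∈ V x (S x)} = ((V x (S x)).toFinset : Set ℕ) := by ext; simp
    change (W (ind (V x (S x)))).encard ≤ ((2 ^ x : ℕ) : ℕ∞)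
    rw [hW, this, Set.encard_coe_eq_coe_finsetCard]
    exact Nat.cast_le.2 ((List.toFinset_card_le _).trans (hlen x (S x)))
  · obtain ⟨s₀, hs₀⟩ := hmem x
    change f x ∈ W (ind (V x (S x)))
    rw [hW]
    have := hs₀ (max s₀ (S x)) (le_max_left _ _)
    rwa [hS x _ (le_max_right _ _)] at this

end Tasks

/-- A path is avoided if some task detects incompatibility with it. -/
theorem Tasks.not_mem_paths (D : Tasks) {A : ℕ → Bool} (p : ℕ)
    (hzero : ∀ n, D.count p (initialSegment A n) = 0)
    (hpos : ∀ τ, (∀ n, τ ≠ initialSegment A n) →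
      ∃ M, ∀ τ', τ <+: τ' → M ≤ τ'.length → 0 < D.count p τ') : A ∉ D.paths := by
  intro hA
  obtain ⟨s₀, h₀⟩ := D.exists_count_le_of_mem_paths hA p 0
  obtain ⟨s₁, h₁⟩ := D.exists_level_stable p
  obtain ⟨s₂, h₂⟩ := D.exists_tree_stable (D.level p s₁ + 1)
  set s := s₀ + s₁ + s₂ with hs
  obtain ⟨σ, k, hσ, hk, -⟩ := h₀ s (by omega)
  rw [h₁ s (by omega)] at hσ
  -- The images of the two successors of `σ` are incomparable, so they cannot both be initial
  -- segments of `A`.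
  obtain ⟨b, hb⟩ : ∃ b : Bool, ∀ n, D.tree s (σ ++ [b]) ≠ initialSegment A n := by
    by_contra! h
    obtain ⟨m, hm⟩ := h false
    obtain ⟨n, hn⟩ := h true
    rcases le_total m n with hmn | hmn
    · refine D.tree_not_prefix s (ρ := σ ++ [false]) (ρ' := σ ++ [true]) ?_ ?_
        (by rw [hm, hn]; exact initialSegment_prefix A hmn) <;>
      simp [List.prefix_append_right_inj]
    · refine D.tree_not_prefix s (ρ := σ ++ [true]) (ρ' := σ ++ [false]) ?_ ?_
        (by rw [hm, hn]; exact initialSegment_prefix A hmn) <;>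
      simp [List.prefix_append_right_inj]
  obtain ⟨M, hM⟩ := hpos _ hb
  -- The `M` padding zeros make the image long enough for the counter to notice the deviation from
  -- `A`.
  obtain ⟨s₃, h₃⟩ := D.exists_count_maximal p (σ ++ ([b] ++ List.replicate M false)).length
  have hst : ∀ ρ : List Bool, ρ.length ≤ D.level p s₁ + 1 → D.tree (s + s₃) ρ = D.tree s ρ :=
    fun ρ hρ => by rw [h₂ _ (by omega) ρ hρ, h₂ s (by omega) ρ hρ]
  have hmax := h₃ (s + s₃) (by omega) σ ([b] ++ List.replicate M false)
    (by rw [hσ, h₁ (s + s₃) (by omega)]) le_rfl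
  rw [hst σ (by omega), hk, hzero, ← List.append_assoc] at hmax
  have := hM (D.tree (s + s₃) (σ ++ [b] ++ List.replicate M false))
    (by rw [← hst (σ ++ [b]) (by simp [hσ])]; exact D.tree_prefix _ (List.prefix_append _ _))
    (le_trans (by simp; omega) (D.length_le_length_tree _ _))
  omega

/-! ### The universal sequence of tasks -/

/-- The maximum of the first `n` values of `g`. -/
def runningMax (g : ℕ → ℕ) : ℕ → ℕ
  | 0 => 0
  | n + 1 => max (runningMax g n) (g n)

theorem runningMax_le_iff {g : ℕ → ℕ} {n b : ℕ} : runningMax g n ≤ b ↔ ∀ k < n, g k ≤ b := by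
  induction n with
  | zero => simp [runningMax]
  | succ n ih => rw [runningMax, max_le_iff, ih, Nat.forall_lt_succ_right]

theorem le_runningMax {g : ℕ → ℕ} {n k : ℕ} (h : k < n) : g k ≤ runningMax g n :=
  runningMax_le_iff.1 le_rfl k h

theorem primrec_runningMax {α : Type*} [Primcodable α] {g : α → ℕ → ℕ} (hg : Primrec₂ g) :
    Primrec₂ fun a n => runningMax (g a) n := by
  refine (Primrec.nat_rec (f := fun _ : α => 0) (g := fun a p => max p.2 (g a p.1))
    (Primrec.const _) (Primrec.nat_max.comp (Primrec.snd.comp Primrec.snd)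
      (hg.comp Primrec.fst (Primrec.fst.comp Primrec.snd)))).of_eq ?_
  intro a n
  induction n with
  | zero => rfl
  | succ n ih => rw [runningMax, ← ih]

/-- The largest value computed by `c` within `τ.length` steps on an initial segment of `τ`. -/
def observedCount (c : Code) (x : ℕ) (τ : List Bool) : ℕ :=
  runningMax (fun n => (c.evaln τ.length (Nat.pair x (encode (τ.take n)))).getD 0) (τ.length + 1)

/-- A longer string allows more steps and more initial segments as inputs, so the maximum grows
whatever `c` computes; arbitrary codes can therefore serve as tasks. -/
theorem observedCount_mono (c : Code) (x : ℕ) {τ τ' : List Bool} (h : τ <+: τ') :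
    observedCount c x τ ≤ observedCount c x τ' := by
  refine runningMax_le_iff.2 fun n hn => ?_
  have hlen := h.length_le
  refine le_trans ?_ (le_runningMax (show n < τ'.length + 1 by omega))
  have htake : τ'.take n = τ.take n := by
    obtain ⟨ρ, rfl⟩ := h
    rw [List.take_append_of_le_length (by omega)]
  rw [htake]
  rcases he : c.evaln τ.length (Nat.pair x (encode (τ.take n))) with _ | v
  · simp
  · have : v ∈ c.evaln τ'.length (Nat.pair x (encode (τ.take n))) := Code.evaln_mono hlen he
    rw [this]

theorem primrec_observedCount :
    Primrec fun q : (Code × ℕ) × List Bool => observedCount q.1.1 q.1.2 q.2 := by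
  have hlen : Primrec fun q : (Code × ℕ) × List Bool => q.2.length :=
    Primrec.list_length.comp Primrec.snd
  refine (primrec_runningMax (α := (Code × ℕ) × List Bool) (g := fun q n =>
    (q.1.1.evaln q.2.length (Nat.pair q.1.2 (encode (q.2.take n)))).getD 0) ?_).comp
    Primrec.id (Primrec.succ.comp hlen)
  refine Primrec.option_getD.comp (Code.primrec_evaln.comp (Primrec.pair (Primrec.pair
    (hlen.comp Primrec.fst) (Primrec.fst.comp (Primrec.fst.comp Primrec.fst)))
    (Primrec₂.natPair.comp (Primrec.snd.comp (Primrec.fst.comp Primrec.fst))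
      (Primrec.encode.comp (Primrec.list_take.comp Primrec.snd
        (Primrec.snd.comp Primrec.fst)))))) (Primrec.const 0)

/-- The codes of a counter and of its bound, an argument, and a number of steps. -/
@[irreducible]
def taskData (i : ℕ) : ((Code × Code) × ℕ) × ℕ :=
  Denumerable.ofNat (((Code × Code) × ℕ) × ℕ) i

/-- The bound of the task `i`, if its computation takes exactly the prescribed number of steps. -/
def taskBound (i : ℕ) : Option ℕ :=
  if encode (taskData i).1.1 ≤ (taskData i).1.2 ∧
      (taskData i).1.1.2.evaln (taskData i).2 (taskData i).1.2 = none
  then (taskData i).1.1.2.evaln ((taskData i).2 + 1) (taskData i).1.2 else none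

/-- The level of the task `i`. -/
def taskLevel (i : ℕ) : ℕ :=
  if taskBound i = none then i else (taskData i).1.2

/-- The counter of the task `i`. -/
def taskCount (i : ℕ) (τ : List Bool) : ℕ :=
  min ((taskBound i).getD 0) (observedCount (taskData i).1.1.1 (taskData i).1.2 τ)

theorem primrec_taskData : Primrec taskData := by
  unfold taskData
  exact Primrec.ofNat _

theorem taskData_encode (q : ((Code × Code) × ℕ) × ℕ) : taskData (encode q) = q := by
  rw [taskData, Denumerable.ofNat_encode]

theorem injective_taskData : Function.Injective taskData := by
  unfold taskData
  exact (Denumerable.eqv (((Code × Code) × ℕ) × ℕ)).symm.injective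

theorem primrec_taskBound : Primrec taskBound := by
  have hx : Primrec fun i => (taskData i).1.2 :=
    Primrec.snd.comp (Primrec.fst.comp primrec_taskData)
  have he : Primrec fun i => (taskData i).1.1 :=
    Primrec.fst.comp (Primrec.fst.comp primrec_taskData)
  have hk : Primrec fun i => (taskData i).2 := Primrec.snd.comp primrec_taskData
  have hd := Primrec.snd.comp he
  exact Primrec.ite ((Primrec.nat_le.comp (Primrec.encode.comp he) hx).and
    (Primrec.eq.comp (Code.primrec_evaln.comp (Primrec.pair (Primrec.pair hk hd) hx))
      (Primrec.const none)))
    (Code.primrec_evaln.comp (Primrec.pair (Primrec.pair (Primrec.succ.comp hk) hd) hx))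
    (Primrec.const none)

theorem primrec_taskLevel : Primrec taskLevel :=
  Primrec.ite (Primrec.eq.comp primrec_taskBound (Primrec.const none)) Primrec.id
    (Primrec.snd.comp (Primrec.fst.comp primrec_taskData))

theorem primrec_taskCount : Primrec₂ taskCount := by
  have hq : Primrec fun p : ℕ × List Bool => taskData p.1 := primrec_taskData.comp Primrec.fst
  exact Primrec.nat_min.comp
    (Primrec.option_getD.comp (primrec_taskBound.comp Primrec.fst) (Primrec.const 0))
    (primrec_observedCount.comp (Primrec.pair (Primrec.pair
      (Primrec.fst.comp (Primrec.fst.comp (Primrec.fst.comp hq)))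
      (Primrec.snd.comp (Primrec.fst.comp hq))) Primrec.snd))

/-- The step number is exact: it is the last one at which the computation of the bound has not yet
halted, hence determined by the code and the argument. -/
theorem injOn_taskData : Set.InjOn (fun i => (taskData i).1) {i | taskBound i ≠ none} := by
  have key : ∀ {i j}, taskBound i ≠ none → taskBound j ≠ none → (taskData i).1 = (taskData j).1 →
      (taskData j).2 ≤ (taskData i).2 := by
    intro i j hi hj he
    by_contra! hlt
    rw [taskBound, ne_eq, ite_eq_right_iff, Classical.not_imp] at hi hj
    rw [he] at hi
    obtain ⟨v, hv⟩ := Option.ne_none_iff_exists'.1 hi.2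
    have := Code.evaln_mono (show (taskData i).2 + 1 ≤ (taskData j).2 from hlt) hv
    rw [hj.1.2] at this
    simp at this
  intro i hi j hj he
  exact injective_taskData (Prod.ext he (le_antisymm (key hj hi he.symm) (key hi hj he)))

/-- Void tasks have their own index as level. For the others the condition `encode (taskData i).1.1
≤ (taskData i).1.2` leaves finitely many codes per level, and each choice of codes and argument
occurs at most once. -/
theorem exists_forall_lt_taskLevel (n : ℕ) : ∃ I, ∀ j ≥ I, n < taskLevel j := by
  have hfin : {i | taskBound i ≠ none ∧ taskLevel i ≤ n}.Finite := by
    refine Set.Finite.of_finite_image (f := fun i => (taskData i).1) ?_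
      (injOn_taskData.mono fun _ hi => hi.1)
    have hE : {e : Code × Code | encode e ≤ n}.Finite :=
      (Set.finite_Iic n).preimage encode_injective.injOn
    refine (hE.prod (Set.finite_Iic n)).subset ?_
    rintro _ ⟨i, ⟨hi, hl⟩, rfl⟩
    rw [taskLevel, if_neg hi] at hl
    rw [taskBound, ne_eq, ite_eq_right_iff, Classical.not_imp] at hi
    exact ⟨hi.1.1.trans hl, hl⟩
  obtain ⟨b, hb⟩ := hfin.bddAbove
  refine ⟨b + n + 1, fun j hj => ?_⟩
  by_contra! hl
  by_cases h : taskBound j = none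
  · rw [taskLevel, if_pos h] at hl
    omega
  · have := hb ⟨h, hl⟩
    omega

/-- The universal sequence of tasks. -/
def universalTasks : Tasks where
  lvl := taskLevel
  count := taskCount
  bound i := (taskBound i).getD 0
  count_mono _ _ _ h := min_le_min_left _ (observedCount_mono _ _ h)
  count_le_bound _ _ := min_le_left _ _
  exists_forall_lt_lvl := exists_forall_lt_taskLevel

theorem lvl_universalTasks : universalTasks.lvl = taskLevel := rfl

theorem count_universalTasks : universalTasks.count = taskCount := rfl

theorem exists_code_of_computable {f : ℕ → ℕ} (hf : Computable f) :
    ∃ c : Code, ∀ n, c.eval n = Part.some (f n) := by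
  obtain ⟨c, hc⟩ := Code.exists_code.1 (Partrec.nat_iff.1 hf.partrec)
  exact ⟨c, fun n => by rw [hc]; rfl⟩

/-- Every computable counter with a computable bound is simulated by the universal sequence. -/
theorem exists_task_index {cnt : ℕ → List Bool → ℕ} {bd : ℕ → ℕ} (hcnt : Computable₂ cnt)
    (hbd : Computable bd) (hmono : ∀ x {τ τ' : List Bool}, τ <+: τ' → cnt x τ ≤ cnt x τ')
    (hle : ∀ x τ, cnt x τ ≤ bd x) :
    ∃ (idx : ℕ → ℕ) (x₀ : ℕ), Computable idx ∧ ∀ x ≥ x₀, universalTasks.lvl (idx x) = x ∧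
      (∀ τ, universalTasks.count (idx x) τ ≤ cnt x τ) ∧
      ∀ τ, ∃ M, ∀ τ', τ <+: τ' → M ≤ τ'.length →
        cnt x τ ≤ universalTasks.count (idx x) τ' := by
  have hcnt' : Computable fun n : ℕ =>
      cnt n.unpair.1 ((decode n.unpair.2 : Option (List Bool)).getD []) :=
    hcnt.comp (Computable.fst.comp Computable.unpair)
      (Computable.option_getD (Computable.decode.comp (Computable.snd.comp Computable.unpair))
        (Computable.const []))
  obtain ⟨c, hc⟩ := exists_code_of_computable hcnt'
  obtain ⟨d, hd⟩ := exists_code_of_computable hbd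
  replace hc : ∀ x τ, c.eval (Nat.pair x (encode τ)) = Part.some (cnt x τ) := fun x τ => by
    simp [hc]
  have hsteps : ∀ x, ∃ k, d.evaln (k + 1) x ≠ none := fun x => by
    obtain ⟨k, hk⟩ := Code.evaln_complete.1 (show bd x ∈ d.eval x by simp [hd])
    refine ⟨k, ?_⟩
    rw [Code.evaln_mono k.le_succ hk]
    simp
  have hfind : Computable fun x => Nat.find (hsteps x) := by
    refine Computable.find (P := fun x k => d.evaln (k + 1) x ≠ none) ?_ hsteps
    refine PrimrecPred.computablePred (PrimrecPred.not (Primrec.eq.comp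
      (Code.primrec_evaln.comp (Primrec.pair (Primrec.pair (Primrec.succ.comp Primrec.snd)
        (Primrec.const d)) Primrec.fst)) (Primrec.const none)))
  -- The threshold `encode (c, d)` is where the codes become admissible for the argument `x`.
  refine ⟨fun x => encode (((c, d), x), Nat.find (hsteps x)), encode (c, d), ?_, fun x hx => ?_⟩
  · exact Computable.encode.comp (Computable.pair
      (Computable.pair (Computable.const (c, d)) Computable.id) hfind)
  have hdata : taskData (encode (((c, d), x), Nat.find (hsteps x))) =
      (((c, d), x), Nat.find (hsteps x)) := taskData_encode _
  have hbound : taskBound (encode (((c, d), x), Nat.find (hsteps x))) = some (bd x) := by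
    have hnone : d.evaln (Nat.find (hsteps x)) x = none := by
      rcases hk : Nat.find (hsteps x) with _ | k
      -- With step bound 0, `evaln` returns nothing, since it only accepts inputs below its bound.
      · exact Option.eq_none_iff_forall_not_mem.2 fun v hv =>
          absurd (Code.evaln_bound hv) (Nat.not_lt_zero x)
      · by_contra h
        exact Nat.find_min (hsteps x) (hk ▸ k.lt_succ_self) h
    rw [taskBound, hdata, if_pos ⟨hx, hnone⟩]
    obtain ⟨v, hv⟩ := Option.ne_none_iff_exists'.1 (Nat.find_spec (hsteps x))
    have := Code.evaln_sound hv
    rw [hd, Part.mem_some_iff] at this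
    exact this ▸ hv
  refine ⟨?_, fun τ => ?_, fun τ => ?_⟩
  · rw [lvl_universalTasks, taskLevel, hbound, if_neg (by simp), hdata]
  · rw [count_universalTasks, taskCount, hdata]
    refine (min_le_right _ _).trans (runningMax_le_iff.2 fun n _ => ?_)
    rcases he : c.evaln τ.length (Nat.pair x (encode (τ.take n))) with _ | v
    · simp
    · have := Code.evaln_sound he
      rw [hc, Part.mem_some_iff] at this
      rw [this]
      exact hmono x (List.take_prefix _ _)
  · obtain ⟨k, hk⟩ := Code.evaln_complete.1
      (show cnt x τ ∈ c.eval (Nat.pair x (encode τ)) by simp [hc])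
    refine ⟨k, fun τ' hp hlen => ?_⟩
    rw [count_universalTasks, taskCount, hbound, hdata]
    refine le_min (hle x τ) (le_trans ?_
      (le_runningMax (show τ.length < τ'.length + 1 from Nat.lt_succ_of_le hp.length_le)))
    dsimp only
    rw [← List.prefix_iff_eq_take.1 hp, Code.evaln_mono hlen hk]
    rfl

/-! ### Members of the universal class -/

theorem computable_initialSegment {A : ℕ → Bool} (hA : Computable A) :
    Computable (initialSegment A) :=
  computable_list_map Primrec.list_range.to_comp (hA.comp Computable.snd)

theorem not_mem_paths_of_computable {A : ℕ → Bool} (hA : Computable A) :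
    A ∉ universalTasks.paths := by
  set cnt : ℕ → List Bool → ℕ :=
    fun _ τ => if τ = initialSegment A τ.length then 0 else 1 with hcnt
  have hcomp : Computable₂ cnt := by
    have hτ : Computable fun p : ℕ × List Bool => p.2 := Computable.snd
    exact (Computable.cond (Primrec.eq.decide.to_comp.comp hτ
      ((computable_initialSegment hA).comp (Computable.list_length.comp hτ)))
      (Computable.const 0) (Computable.const 1)).of_eq fun p => Bool.cond_decide _ _ _
  have hmono : ∀ x {τ τ' : List Bool}, τ <+: τ' → cnt x τ ≤ cnt x τ' := by
    intro x τ τ' hp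
    by_cases h : τ' = initialSegment A τ'.length
    · have h' : τ = initialSegment A τ.length := eq_initialSegment_of_prefix (h ▸ hp)
      simp only [hcnt]
      rw [if_pos h']
      exact Nat.zero_le _
    · simp only [hcnt]
      rw [if_neg h]
      split_ifs <;> omega
  obtain ⟨idx, x₀, -, hidx⟩ := exists_task_index hcomp (Computable.const 1) hmono
    (fun x τ => by simp only [hcnt]; split_ifs <;> omega)
  obtain ⟨-, hle, hge⟩ := hidx x₀ le_rfl
  refine universalTasks.not_mem_paths (idx x₀) (fun n => ?_) fun τ hτ => ?_
  · refine Nat.le_zero.1 ((hle _).trans ?_)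
    simp [hcnt, length_initialSegment]
  · obtain ⟨M, hM⟩ := hge τ
    refine ⟨M, fun τ' hp hlen => lt_of_lt_of_le ?_ (hM τ' hp hlen)⟩
    simp only [hcnt]
    rw [if_neg (hτ _)]
    exact Nat.one_pos

theorem primrec_lvl_universalTasks : Primrec universalTasks.lvl := primrec_taskLevel

theorem primrec_count_universalTasks : Primrec₂ universalTasks.count := primrec_taskCount

theorem primrec_bound_universalTasks : Primrec universalTasks.bound :=
  Primrec.option_getD.comp primrec_taskBound (Primrec.const 0)

theorem isBLRTraceableWithBound_of_mem_paths {A : ℕ → Bool} (hA : A ∈ universalTasks.paths) :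
    IsBLRTraceableWithBound A fun n => 2 ^ n := by
  intro f hf
  obtain ⟨cnt, val, bd, hc, hlim⟩ := exists_isCounter hf
  obtain ⟨idx, x₀, hcomp, hidx⟩ := exists_task_index hc.computable_cnt hc.computable_bd
    hc.cnt_mono hc.cnt_le
  refine Tasks.hasBLRTraceWithBound primrec_lvl_universalTasks primrec_count_universalTasks
    primrec_bound_universalTasks.to_comp hA hc hlim hcomp
    (fun x hx => (hidx x hx).1.le) (fun x hx => (hidx x hx).2.1) fun x hx n => ?_
  obtain ⟨M, hM⟩ := (hidx x hx).2.2 (initialSegment A n)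
  exact ⟨max n M, hM _ (initialSegment_prefix A (le_max_left _ _))
    (by rw [length_initialSegment]; exact le_max_right _ _)⟩

theorem isOrderFunction_two_pow : IsOrderFunction fun n => 2 ^ n where
  computable := (primrec_pow.comp (Primrec.const 2) Primrec.id).to_comp
  monotone := pow_right_mono₀ (by norm_num)
  unbounded k := ⟨k, Nat.lt_two_pow_self.le⟩

end BLR

theorem mainTheorem10 :
    ∃ P : Set (ℕ → Bool), BLR.IsSpecialPi01Class P ∧
      ∀ A ∈ P, BLR.IsBLRTraceable A ∧ BLR.IsBLRTraceableWithBound A (fun n => 2 ^ n) :=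
  ⟨BLR.universalTasks.paths,
    ⟨BLR.Tasks.isPi01Class_paths BLR.primrec_lvl_universalTasks
      BLR.primrec_count_universalTasks,
      BLR.universalTasks.paths_nonempty,
      fun _ hA hc => BLR.not_mem_paths_of_computable hc hA⟩,
    fun _ hA => ⟨⟨_, BLR.isOrderFunction_two_pow, BLR.isBLRTraceableWithBound_of_mem_paths hA⟩,
      BLR.isBLRTraceableWithBound_of_mem_paths hA⟩⟩
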